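/- For $n\ge 4$ let $\mathcal{A}_n$ be the associahedron graph: its vertices are the triangulations of a convex $n$-gon (sets of $n-3$ pairwise non-crossing diagonals), and two distinct triangulations are adjacent if they share exactly $n-4$ diagonals. Let $\lambda_{\min}(\mathcal{A}_n)$ be the smallest eigenvalue of its adjacency matrix. Then: (i) there are real constants $c_0,\dots,c_9$ such that for every $n\ge 4$, with $r$ the remainder of $n$ on division by $10$, $$\lambda_{\min}(\mathcal{A}_n)\le -0.6904\,n+c_r;$$ (ii) the limit $\lim_{n\to\infty}\frac{\lambda_{\min}(\mathcal{A}_n)}{n-3}$ exists and $$-\frac{5+\sqrt5}{8}\le\lim_{n\to\infty}\frac{\lambda_{\min}(\mathcal{A}_n)}{n-3}\le -0.6904;$$ (iii) $|\lambda_{\min}(\mathcal{A}_n)|=\Theta(n)$ as $n\to\infty$. -/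

import Mathlib

/-- The smallest eigenvalue of the adjacency matrix of a finite graph
(for a nonempty vertex set it is attained, see `isLeast_smallestEigenvalue`). -/
noncomputable def SimpleGraph.smallestEigenvalue {V : Type*} [Fintype V] [DecidableEq V]
    (G : SimpleGraph V) [DecidableRel G.Adj] : ℝ :=
  sInf {μ : ℝ | Module.End.HasEigenvalue (Matrix.toLin' (G.adjMatrix ℝ)) μ}

theorem SimpleGraph.isLeast_smallestEigenvalue {V : Type*} [Fintype V] [DecidableEq V] [Nonempty V]
    (G : SimpleGraph V) [DecidableRel G.Adj] :
    IsLeast {μ : ℝ | Module.End.HasEigenvalue (Matrix.toLin' (G.adjMatrix ℝ)) μ}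
      G.smallestEigenvalue := by
  have hfin : {μ : ℝ | Module.End.HasEigenvalue (Matrix.toLin' (G.adjMatrix ℝ)) μ}.Finite :=
    Module.End.finite_hasEigenvalue _
  have hA : (G.adjMatrix ℝ).IsHermitian := G.isHermitian_adjMatrix ℝ
  obtain ⟨i⟩ := ‹Nonempty V›
  have hne : {μ : ℝ | Module.End.HasEigenvalue (Matrix.toLin' (G.adjMatrix ℝ)) μ}.Nonempty := by
    refine ⟨hA.eigenvalues i, Module.End.hasEigenvalue_of_hasEigenvector
      (x := (hA.eigenvectorBasis i : V → ℝ)) ⟨?_, ?_⟩⟩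
    · rw [Module.End.mem_eigenspace_iff, Matrix.toLin'_apply]
      exact hA.mulVec_eigenvectorBasis i
    · intro h
      apply hA.eigenvectorBasis.orthonormal.ne_zero i
      ext j
      exact congrFun h j
  exact ⟨hne.csInf_mem hfin, fun μ hμ => csInf_le hfin.bddBelow hμ⟩

namespace Associahedron

/-- The vertices of a convex `n`-gon are labelled `0, …, n - 1` in cyclic order. A diagonal is
a pair `(i, j)` with `i < j` of vertices that are not joined by a side of the polygon. -/
def IsDiagonal (n : ℕ) (d : Fin n × Fin n) : Prop :=
  d.1.val + 2 ≤ d.2.val ∧ ¬ (d.1.val = 0 ∧ d.2.val + 1 = n)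

/-- Two diagonals cross (meet in the interior of the polygon) when their endpoints strictly
alternate around the polygon. -/
def Crosses {n : ℕ} (d e : Fin n × Fin n) : Prop :=
  (d.1 < e.1 ∧ e.1 < d.2 ∧ d.2 < e.2) ∨ (e.1 < d.1 ∧ d.1 < e.2 ∧ e.2 < d.2)

instance (n : ℕ) : DecidablePred (IsDiagonal n) := fun d => by
  unfold IsDiagonal; infer_instance

instance (n : ℕ) : DecidableRel (Crosses (n := n)) := fun d e => by
  unfold Crosses; infer_instance

/-- A triangulation of the convex `n`-gon: a set of `n - 3` pairwise non-crossing diagonals. -/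
abbrev Triangulation (n : ℕ) : Type :=
  {T : Finset (Fin n × Fin n) //
    (∀ d ∈ T, IsDiagonal n d) ∧ (∀ d ∈ T, ∀ e ∈ T, ¬ Crosses d e) ∧ T.card = n - 3}

/-- The flip graph on the triangulations of the convex `n`-gon (`4 ≤ n`): distinct triangulations
are adjacent when they share `n - 4` diagonals. -/
def graph (n : ℕ) : SimpleGraph (Triangulation n) where
  Adj S T := S ≠ T ∧ (S.1 ∩ T.1).card = n - 4
  symm := ⟨fun S T h => ⟨h.1.symm, by rw [Finset.inter_comm]; exact h.2⟩⟩
  loopless := ⟨fun _ h => h.1 rfl⟩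

instance (n : ℕ) : DecidableRel (graph n).Adj := fun S T => by
  unfold graph; infer_instance

/-- The smallest eigenvalue of the associahedron graph. -/
noncomputable def lambdaMin (n : ℕ) : ℝ := (graph n).smallestEigenvalue

/-- The fan triangulation: all diagonals through the vertex `0`. -/
theorem nonempty_triangulation {n : ℕ} (hn : 4 ≤ n) : Nonempty (Triangulation n) := by
  let f : Fin (n - 3) → Fin n × Fin n := fun i => (⟨0, by omega⟩, ⟨i.val + 2, by omega⟩)
  have hf : Function.Injective f := by
    intro i j h
    have := congrArg (fun p => p.2.val) h
    simp only [f] at this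
    exact Fin.ext (by omega)
  refine ⟨⟨Finset.univ.image f, ?_, ?_, ?_⟩⟩
  · intro d hd
    obtain ⟨i, -, rfl⟩ := Finset.mem_image.1 hd
    have := i.isLt
    refine ⟨?_, ?_⟩ <;> simp only [f] <;> omega
  · intro d hd e he
    obtain ⟨i, -, rfl⟩ := Finset.mem_image.1 hd
    obtain ⟨j, -, rfl⟩ := Finset.mem_image.1 he
    simp [Crosses, f]
  · rw [Finset.card_image_of_injective _ hf, Finset.card_univ, Fintype.card_fin]

end Associahedron

/-! Triangulations of an `(m + 2)`-gon are dual to binary trees with `m` nodes, and flips to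
rotations (`treeGraphIso`). The quadratic form `rotForm` of the rotation graph splits recursively
into rotations inside the left subtree, inside the right subtree, and at the root (`rotForm_eq`).

Upper bound and limit. Placing least eigenfunctions for `i` and `j` nodes on the two subtrees of a
root gives a test function whose Rayleigh quotient is the sum of the two eigenvalues. So the least
eigenvalue is subadditive in the number of leaves (`treeMin_add_le`), Fekete's lemma gives the
limit, and one `m` with `treeMin m < -0.6904 * (m + 1)` settles all the upper bounds. Such an `m`
comes from averaging (`exists_treeMin_lt`): `spineWeight L` lives on trees of many sizes and is a
product of fixed weights over the subtrees hanging off the left spine. A rotation on the spine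
merges two neighbouring blocks, and the weights correlate negatively under merging. The form divided
by the size-weighted norm tends to `-2362/3383 ≈ -0.698`, and some size does at least as well as the
average.

Lower bound. Three connected nodes with four hanging subtrees can be arranged in five ways, which
form a pentagon of rotations; its least eigenvalue is `-φ`, better than the trivial `-2`. A rotation
of `(a △ b) △ c` lies in at most four pentagons: one for each nonempty tree among `a`, `b`, `c`, and
one for the parent node. Summing the pentagon inequalities with weight `1/4`, and using `2xy ≥ -(x²
+ y²)` where a pentagon is missing, charges each tree a cost that telescopes to at most `(φ + 2)/4 =
(5 + √5)/8` per node (`neg_le_treeMin`). -/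

namespace SimpleGraph

/-! ### Variational characterization of the smallest eigenvalue -/

variable {V W : Type*} [Fintype V] [DecidableEq V] [Fintype W] [DecidableEq W]

theorem toLin'_adjMatrix_apply (G : SimpleGraph V) [DecidableRel G.Adj] (x : V → ℝ) (i : V) :
    Matrix.toLin' (G.adjMatrix ℝ) x i = ∑ j, if G.Adj i j then x j else 0 := by
  simp [Matrix.toLin'_apply, Matrix.mulVec, dotProduct, adjMatrix_apply]

theorem exists_smallestEigenvalue_eigenfunction [Nonempty V] (G : SimpleGraph V)
    [DecidableRel G.Adj] :
    ∃ x : V → ℝ, x ≠ 0 ∧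
      ∀ i, (∑ j, if G.Adj i j then x j else 0) = G.smallestEigenvalue * x i := by
  obtain ⟨x, hx, hx0⟩ := (isLeast_smallestEigenvalue G).1.exists_hasEigenvector
  refine ⟨x, hx0, fun i => ?_⟩
  rw [Module.End.mem_eigenspace_iff] at hx
  rw [← toLin'_adjMatrix_apply, hx, Pi.smul_apply, smul_eq_mul]

/-- The matrix `A - λ_min • 1` is positive semidefinite: each of its eigenvalues, shifted back by
`λ_min`, is an eigenvalue of `A`. -/
theorem smallestEigenvalue_mul_sum_sq_le [Nonempty V] (G : SimpleGraph V) [DecidableRel G.Adj]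
    (x : V → ℝ) :
    G.smallestEigenvalue * ∑ i, x i ^ 2 ≤ ∑ i, x i * ∑ j, if G.Adj i j then x j else 0 := by
  set M : Matrix V V ℝ := G.adjMatrix ℝ - G.smallestEigenvalue • (1 : Matrix V V ℝ) with hM
  have hH : M.IsHermitian := by
    refine (G.isHermitian_adjMatrix ℝ).sub ?_
    simp [Matrix.IsHermitian]
  have hpos : M.PosSemidef := by
    rw [hH.posSemidef_iff_eigenvalues_nonneg]
    intro i
    have h1 := hH.mulVec_eigenvectorBasis i
    have h2 : Module.End.HasEigenvalue (Matrix.toLin' (G.adjMatrix ℝ))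
        (hH.eigenvalues i + G.smallestEigenvalue) := by
      refine Module.End.hasEigenvalue_of_hasEigenvector
        (x := (hH.eigenvectorBasis i : V → ℝ)) ⟨?_, ?_⟩
      · rw [Module.End.mem_eigenspace_iff, Matrix.toLin'_apply]
        have h4 : ∀ y : V → ℝ, (G.adjMatrix ℝ).mulVec y = M.mulVec y + G.smallestEigenvalue • y := by
          intro y
          rw [hM, Matrix.sub_mulVec, Matrix.smul_mulVec, Matrix.one_mulVec, sub_add_cancel]
        rw [h4, h1, add_smul]
      · intro h
        apply hH.eigenvectorBasis.orthonormal.ne_zero i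
        ext j
        exact congrFun h j
    have h3 := (isLeast_smallestEigenvalue G).2 h2
    simp only [Pi.zero_apply]
    linarith
  have h := hpos.dotProduct_mulVec_nonneg x
  rw [hM, Matrix.sub_mulVec, Matrix.smul_mulVec, Matrix.one_mulVec, dotProduct_sub,
    dotProduct_smul] at h
  simp only [dotProduct, ← Matrix.toLin'_apply, toLin'_adjMatrix_apply, star_trivial,
    smul_eq_mul] at h
  simp only [pow_two]
  linarith

theorem smallestEigenvalue_congr (G : SimpleGraph V) [DecidableRel G.Adj]
    (H : SimpleGraph W) [DecidableRel H.Adj] (e : G ≃g H) :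
    G.smallestEigenvalue = H.smallestEigenvalue := by
  unfold smallestEigenvalue
  congr 1
  ext μ
  simp only [Set.mem_ofPred_eq]
  have key : ∀ (x : W → ℝ) (i : V),
      Matrix.toLin' (G.adjMatrix ℝ) (x ∘ e) i = Matrix.toLin' (H.adjMatrix ℝ) x (e i) := by
    intro x i
    rw [toLin'_adjMatrix_apply, toLin'_adjMatrix_apply, ← e.toEquiv.sum_comp]
    refine Finset.sum_congr rfl fun j _ => ?_
    have h : H.Adj (e i) (e.toEquiv j) ↔ G.Adj i j := e.map_adj_iff
    simp only [h]
    rfl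
  constructor
  · intro h
    obtain ⟨x, hx, hx0⟩ := h.exists_hasEigenvector
    obtain ⟨y, rfl⟩ : ∃ y : W → ℝ, x = y ∘ e := ⟨x ∘ e.symm, by ext; simp⟩
    rw [Module.End.mem_eigenspace_iff] at hx
    refine Module.End.hasEigenvalue_of_hasEigenvector (x := y) ⟨?_, ?_⟩
    · rw [Module.End.mem_eigenspace_iff]
      ext j
      have := congrFun hx (e.symm j)
      rw [key] at this
      simpa using this
    · rintro rfl
      exact hx0 rfl
  · intro h
    obtain ⟨y, hy, hy0⟩ := h.exists_hasEigenvector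
    rw [Module.End.mem_eigenspace_iff] at hy
    refine Module.End.hasEigenvalue_of_hasEigenvector (x := y ∘ e) ⟨?_, ?_⟩
    · rw [Module.End.mem_eigenspace_iff]
      ext i
      rw [key, hy]
      rfl
    · intro h0
      apply hy0
      ext j
      simpa using congrFun h0 (e.symm j)

end SimpleGraph

/-! ### Binary trees as maximal noncrossing families of intervals -/

namespace Associahedron

open BinaryTree

/-- The intervals `(a, b)` cut out by the nodes of a binary tree whose leaves are the unit
intervals `(i, i + 1)`, `(i + 1, i + 2)`, and so on. -/
def intervals : BinaryTree Unit → ℕ → Finset (ℕ × ℕ)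
  | .nil, _ => ∅
  | .node _ l r, i => insert (i, i + l.numNodes + r.numNodes + 2)
      (intervals l i ∪ intervals r (i + l.numNodes + 1))

/-- `Rotates s t` holds when `t` arises from `s` by a right rotation at one of its nodes. -/
inductive Rotates : BinaryTree Unit → BinaryTree Unit → Prop
  | root (a b c) : Rotates ((a △ b) △ c) (a △ b △ c)
  | left {l l'} (r) : Rotates l l' → Rotates (l △ r) (l' △ r)
  | right (l) {r r'} : Rotates r r' → Rotates (l △ r) (l △ r')

theorem Rotates.numNodes_eq {s t : BinaryTree Unit} (h : Rotates s t) :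
    s.numNodes = t.numNodes := by
  induction h with
  | root a b c => simp only [numNodes]; omega
  | left r _ ih => simp only [numNodes]; omega
  | right l _ ih => simp only [numNodes]; omega

theorem mem_intervals_node {l r : BinaryTree Unit} {i : ℕ} {p : ℕ × ℕ} :
    p ∈ intervals (l △ r) i ↔ p = (i, i + l.numNodes + r.numNodes + 2) ∨
      p ∈ intervals l i ∨ p ∈ intervals r (i + l.numNodes + 1) := by
  simp [intervals]

theorem bounds_of_mem_intervals {t : BinaryTree Unit} {i a b : ℕ} (h : (a, b) ∈ intervals t i) :
    i ≤ a ∧ a + 2 ≤ b ∧ b ≤ i + t.numNodes + 1 := by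
  induction t using unitRecOn generalizing i with
  | base => simp [intervals] at h
  | ind l r ihl ihr =>
    simp only [numNodes]
    rcases mem_intervals_node.1 h with h | h | h
    · simp only [Prod.mk.injEq] at h; omega
    · have := ihl h; omega
    · have := ihr h; omega

theorem root_mem_intervals {t : BinaryTree Unit} (i : ℕ) (h : 1 ≤ t.numNodes) :
    (i, i + t.numNodes + 1) ∈ intervals t i := by
  cases t with
  | nil => simp at h
  | node _ l r => exact mem_intervals_node.2 (Or.inl (by simp only [numNodes, Prod.mk.injEq, true_and]; omega))

theorem mem_intervals_left {l r : BinaryTree Unit} {i a b : ℕ}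
    (h : (a, b) ∈ intervals (l △ r) i) (hb : b ≤ i + l.numNodes + 1) : (a, b) ∈ intervals l i := by
  rcases mem_intervals_node.1 h with h | h | h
  · simp only [Prod.mk.injEq] at h; omega
  · exact h
  · have := bounds_of_mem_intervals h; omega

theorem mem_intervals_right {l r : BinaryTree Unit} {i a b : ℕ}
    (h : (a, b) ∈ intervals (l △ r) i) (ha : i + l.numNodes + 1 ≤ a) :
    (a, b) ∈ intervals r (i + l.numNodes + 1) := by
  rcases mem_intervals_node.1 h with h | h | h
  · simp only [Prod.mk.injEq] at h; omega
  · have := bounds_of_mem_intervals h; omega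
  · exact h

theorem card_intervals (t : BinaryTree Unit) (i : ℕ) : (intervals t i).card = t.numNodes := by
  induction t using unitRecOn generalizing i with
  | base => rfl
  | ind l r ihl ihr =>
    rw [intervals, Finset.card_insert_of_notMem, Finset.card_union_of_disjoint, ihl, ihr, numNodes]
    · rw [Finset.disjoint_left]
      rintro ⟨a, b⟩ h h'
      have := bounds_of_mem_intervals h
      have := bounds_of_mem_intervals h'
      omega
    · rw [Finset.mem_union]
      rintro (h | h) <;> have := bounds_of_mem_intervals h <;> omega

theorem not_crossing_of_mem_intervals {t : BinaryTree Unit} {i a b c d : ℕ}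
    (h : (a, b) ∈ intervals t i) (h' : (c, d) ∈ intervals t i) : ¬ (a < c ∧ c < b ∧ b < d) := by
  induction t using unitRecOn generalizing i with
  | base => simp [intervals] at h
  | ind l r ihl ihr =>
    have hb := bounds_of_mem_intervals h
    have hb' := bounds_of_mem_intervals h'
    simp only [numNodes] at hb hb'
    rcases mem_intervals_node.1 h with h | h | h <;> rcases mem_intervals_node.1 h' with h' | h' | h'
    · simp only [Prod.mk.injEq] at h h'; omega
    · simp only [Prod.mk.injEq] at h; omega
    · simp only [Prod.mk.injEq] at h; omega
    · simp only [Prod.mk.injEq] at h'; omega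
    · exact ihl h h'
    · have := bounds_of_mem_intervals h
      have := bounds_of_mem_intervals h'
      omega
    · simp only [Prod.mk.injEq] at h'; omega
    · have := bounds_of_mem_intervals h
      have := bounds_of_mem_intervals h'
      omega
    · exact ihr h h'

/-- The interval has the split point `i + l.numNodes + 1` in its interior; in `l △ r` only the root
interval does, and that one is longer. -/
theorem not_intervals_subset_of_lt {l r l' r' : BinaryTree Unit} {i : ℕ}
    (hc : (l △ r).numNodes = (l' △ r').numNodes) (hlt : l.numNodes < l'.numNodes) :
    (i, i + l'.numNodes + 1) ∉ intervals (l △ r) i := by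
  intro h
  simp only [numNodes] at hc
  rcases mem_intervals_node.1 h with h | h | h
  · simp only [Prod.mk.injEq] at h; omega
  · have := bounds_of_mem_intervals h; omega
  · have := bounds_of_mem_intervals h; omega

/-- Equal cardinalities turn inclusion into equality. The split point at the root can then be read
off, since the root interval of the larger left subtree could not occur in the other tree; recursion
does the rest. -/
theorem eq_of_intervals_subset {s t : BinaryTree Unit} {i : ℕ}
    (hc : s.numNodes = t.numNodes) (h : intervals s i ⊆ intervals t i) : s = t := by
  induction s using unitRecOn generalizing t i with
  | base =>
    cases t with
    | nil => rfl
    | node _ l r => simp at hc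
  | ind l r ihl ihr =>
    cases t with
    | nil => simp at hc
    | node _ l' r' =>
      have heq : intervals (l △ r) i = intervals (l' △ r') i :=
        Finset.eq_of_subset_of_card_le h (by rw [card_intervals, card_intervals, hc])
      have hll : l.numNodes = l'.numNodes := by
        rcases lt_trichotomy l.numNodes l'.numNodes with h1 | h1 | h1
        · refine absurd ?_ (not_intervals_subset_of_lt (i := i) hc h1)
          rw [heq]
          exact mem_intervals_node.2 (Or.inr (Or.inl (root_mem_intervals i (by omega))))
        · exact h1
        · refine absurd ?_ (not_intervals_subset_of_lt (i := i) hc.symm h1)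
          rw [← heq]
          exact mem_intervals_node.2 (Or.inr (Or.inl (root_mem_intervals i (by omega))))
      have hrr : r.numNodes = r'.numNodes := by simp only [numNodes] at hc; omega
      have h1 : l = l' := ihl (i := i) hll (by
        rintro ⟨a, b⟩ hab
        have := bounds_of_mem_intervals hab
        exact mem_intervals_left (h (mem_intervals_node.2 (Or.inr (Or.inl hab)))) (by omega))
      have h2 : r = r' := ihr (i := i + l.numNodes + 1) hrr (by
        rintro ⟨a, b⟩ hab
        have := bounds_of_mem_intervals hab
        rw [hll]
        exact mem_intervals_right (h (mem_intervals_node.2 (Or.inr (Or.inr hab)))) (by omega))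
      rw [h1, h2]

theorem Rotates.exists_subset_insert {s t : BinaryTree Unit} (h : Rotates s t) (i : ℕ) :
    ∃ p, intervals s i ⊆ insert p (intervals t i) := by
  induction h generalizing i with
  | root a b c =>
    refine ⟨(i, i + a.numNodes + b.numNodes + 2), fun p hp => ?_⟩
    simp only [intervals, numNodes, Finset.mem_insert, Finset.mem_union] at hp ⊢
    grind
  | @left l l' r hr ih =>
    obtain ⟨p, hp⟩ := ih i
    refine ⟨p, fun q hq => ?_⟩
    have := hr.numNodes_eq
    have := @hp q
    simp only [intervals, Finset.mem_insert, Finset.mem_union] at hq this ⊢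
    grind
  | @right l r r' hr ih =>
    obtain ⟨p, hp⟩ := ih (i + l.numNodes + 1)
    refine ⟨p, fun q hq => ?_⟩
    have := hr.numNodes_eq
    have := @hp q
    simp only [intervals, Finset.mem_insert, Finset.mem_union] at hq this ⊢
    grind

/-- The root interval of `l'` is the one interval allowed to be missing from `l △ r`. With `l' = a △
b`, all others survive; this forces `a` to have the size of `l` and then `a △ b △ r' = l △ r`. -/
theorem rotates_of_card_sdiff_of_lt {l r l' r' : BinaryTree Unit} {i : ℕ}
    (hc : (l △ r).numNodes = (l' △ r').numNodes) (hlt : l.numNodes < l'.numNodes)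
    (h : (intervals (l' △ r') i \ intervals (l △ r) i).card ≤ 1) :
    Rotates (l' △ r') (l △ r) := by
  cases l' with
  | nil => simp at hlt
  | node u a b =>
    have hroot : (i, i + (a △ b).numNodes + 1) ∈
        intervals ((a △ b) △ r') i \ intervals (l △ r) i := by
      rw [Finset.mem_sdiff]
      exact ⟨mem_intervals_node.2 (Or.inr (Or.inl (root_mem_intervals i (by simp)))),
        not_intervals_subset_of_lt hc hlt⟩
    have hmem : ∀ p ∈ intervals ((a △ b) △ r') i, p ≠ (i, i + (a △ b).numNodes + 1) →
        p ∈ intervals (l △ r) i := by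
      intro p hp hne
      by_contra hp'
      exact hne (Finset.card_le_one.1 h p (Finset.mem_sdiff.2 ⟨hp, hp'⟩) _ hroot)
    have hc' := hc
    simp only [numNodes] at hc' hlt hmem
    have ha : a.numNodes = l.numNodes := by
      rcases lt_trichotomy a.numNodes l.numNodes with h1 | h1 | h1
      · have h2 : (i + a.numNodes + 1, i + a.numNodes + 1 + b.numNodes + 1) ∈
            intervals (l △ r) i := by
          refine hmem _ (mem_intervals_node.2 (Or.inr (Or.inl (mem_intervals_node.2
            (Or.inr (Or.inr (root_mem_intervals _ (by omega)))))))) ?_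
          simp only [ne_eq, Prod.mk.injEq]; omega
        rcases mem_intervals_node.1 h2 with h2 | h2 | h2
        · simp only [Prod.mk.injEq] at h2; omega
        · have := bounds_of_mem_intervals h2; omega
        · have := bounds_of_mem_intervals h2; omega
      · exact h1
      · have h2 : (i, i + a.numNodes + 1) ∈ intervals (l △ r) i := by
          refine hmem _ (mem_intervals_node.2 (Or.inr (Or.inl (mem_intervals_node.2
            (Or.inr (Or.inl (root_mem_intervals _ (by omega)))))))) ?_
          simp only [ne_eq, Prod.mk.injEq]; omega
        rcases mem_intervals_node.1 h2 with h2 | h2 | h2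
        · simp only [Prod.mk.injEq] at h2; omega
        · have := bounds_of_mem_intervals h2; omega
        · have := bounds_of_mem_intervals h2; omega
    have hrn : 1 ≤ r.numNodes := by omega
    have hcc : (a △ b △ r').numNodes = (l △ r).numNodes := by simp only [numNodes]; omega
    have heq : a △ b △ r' = l △ r := by
      refine eq_of_intervals_subset (i := i) hcc ?_
      rintro ⟨x, y⟩ hp
      rcases mem_intervals_node.1 hp with hp | hp | hp
      · rw [hp]
        exact mem_intervals_node.2 (Or.inl (by simp only [numNodes, Prod.mk.injEq, true_and]; omega))
      · have := bounds_of_mem_intervals hp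
        refine hmem _ (mem_intervals_node.2 (Or.inr (Or.inl (mem_intervals_node.2
            (Or.inr (Or.inl hp)))))) ?_
        simp only [ne_eq, Prod.mk.injEq]; omega
      · have := bounds_of_mem_intervals hp
        rcases mem_intervals_node.1 hp with hp | hp | hp
        · refine mem_intervals_node.2 (Or.inr (Or.inr ?_))
          convert root_mem_intervals (i + l.numNodes + 1) hrn using 1
          rw [hp]
          simp only [Prod.mk.injEq]; omega
        · refine hmem _ (mem_intervals_node.2 (Or.inr (Or.inl (mem_intervals_node.2
            (Or.inr (Or.inr hp)))))) ?_
          simp only [ne_eq, Prod.mk.injEq]; omega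
        · refine hmem _ (mem_intervals_node.2 (Or.inr (Or.inr ?_))) ?_
          · convert hp using 2
            simp only [numNodes]; omega
          · simp only [ne_eq, Prod.mk.injEq]; omega
    rw [← heq]
    exact Rotates.root a b r'

/-- If the root splits differ, the rotation is at the root. If they agree and the left subtrees
differ, these use up the single permitted difference, so the right subtrees coincide. -/
theorem rotates_or_rotates_of_card_sdiff {s t : BinaryTree Unit} {i : ℕ}
    (hc : s.numNodes = t.numNodes) (hne : s ≠ t)
    (h : (intervals s i \ intervals t i).card ≤ 1) : Rotates s t ∨ Rotates t s := by
  have h' : (intervals t i \ intervals s i).card ≤ 1 := by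
    rwa [Finset.card_sdiff_comm (by rw [card_intervals, card_intervals, hc])]
  induction s using unitRecOn generalizing t i with
  | base =>
    cases t with
    | nil => exact absurd rfl hne
    | node _ l r => simp at hc
  | ind l r ihl ihr =>
    cases t with
    | nil => simp at hc
    | node _ l' r' =>
      rcases lt_trichotomy l.numNodes l'.numNodes with h1 | h1 | h1
      · exact Or.inr (rotates_of_card_sdiff_of_lt hc h1 h')
      · have hrr : r.numNodes = r'.numNodes := by simp only [numNodes] at hc; omega
        have hl : ∀ l r l' r' : BinaryTree Unit, l.numNodes = l'.numNodes →
            intervals l i \ intervals l' i ⊆ intervals (l △ r) i \ intervals (l' △ r') i := by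
          rintro l r l' r' h1 ⟨a, b⟩ hp
          rw [Finset.mem_sdiff] at hp ⊢
          refine ⟨mem_intervals_node.2 (Or.inr (Or.inl hp.1)), fun hn => hp.2 ?_⟩
          have := bounds_of_mem_intervals hp.1
          exact mem_intervals_left hn (by omega)
        have hr : ∀ l r l' r' : BinaryTree Unit, l.numNodes = l'.numNodes →
            intervals r (i + l.numNodes + 1) \ intervals r' (i + l.numNodes + 1) ⊆
              intervals (l △ r) i \ intervals (l' △ r') i := by
          rintro l r l' r' h1 ⟨a, b⟩ hp
          rw [Finset.mem_sdiff] at hp ⊢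
          refine ⟨mem_intervals_node.2 (Or.inr (Or.inr hp.1)), fun hn => hp.2 ?_⟩
          have := bounds_of_mem_intervals hp.1
          rw [h1]
          exact mem_intervals_right hn (by omega)
        by_cases hll : l = l'
        · subst hll
          have hne' : r ≠ r' := by rintro rfl; exact hne rfl
          rcases ihr hrr hne' ((Finset.card_le_card (hr l r l r' rfl)).trans h)
            ((Finset.card_le_card (hr l r' l r rfl)).trans h') with h2 | h2
          · exact Or.inl (Rotates.right l h2)
          · exact Or.inr (Rotates.right l h2)
        · have hsub : intervals r (i + l.numNodes + 1) ⊆ intervals r' (i + l.numNodes + 1) := by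
            rintro ⟨a, b⟩ hp
            by_contra hn
            obtain ⟨⟨c, d⟩, hq, hq'⟩ := Finset.not_subset.1
              (fun h2 : intervals l i ⊆ intervals l' i => hll (eq_of_intervals_subset h1 h2))
            have h3 := Finset.card_le_one.1 h _ (hr l r l' r' h1 (Finset.mem_sdiff.2 ⟨hp, hn⟩)) _
              (hl l r l' r' h1 (Finset.mem_sdiff.2 ⟨hq, hq'⟩))
            have := bounds_of_mem_intervals hp
            have := bounds_of_mem_intervals hq
            simp only [Prod.mk.injEq] at h3; omega
          have h4 : r = r' := eq_of_intervals_subset hrr hsub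
          subst h4
          rcases ihl h1 hll ((Finset.card_le_card (hl l r l' r h1)).trans h)
            ((Finset.card_le_card (hl l' r l r h1.symm)).trans h') with h2 | h2
          · exact Or.inl (Rotates.left r h2)
          · exact Or.inr (Rotates.left r h2)
      · exact Or.inl (rotates_of_card_sdiff_of_lt hc.symm h1 h)

theorem rotates_or_rotates_iff {s t : BinaryTree Unit} {i : ℕ} (hc : s.numNodes = t.numNodes)
    (hne : s ≠ t) : (Rotates s t ∨ Rotates t s) ↔
      (intervals s i ∩ intervals t i).card + 1 = s.numNodes := by
  have hcard := Finset.card_sdiff_add_card_inter (intervals s i) (intervals t i)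
  rw [card_intervals] at hcard
  constructor
  · intro h
    have h1 : (intervals s i \ intervals t i).card ≤ 1 := by
      rcases h with h | h
      · obtain ⟨p, hp⟩ := h.exists_subset_insert i
        refine (Finset.card_le_card (t := {p}) ?_).trans (by simp)
        intro q hq
        have := hp (Finset.mem_sdiff.1 hq).1
        simp_all
      · obtain ⟨p, hp⟩ := h.exists_subset_insert i
        rw [Finset.card_sdiff_comm (by rw [card_intervals, card_intervals, hc])]
        refine (Finset.card_le_card (t := {p}) ?_).trans (by simp)
        intro q hq
        have := hp (Finset.mem_sdiff.1 hq).1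
        simp_all
    have h2 : (intervals s i \ intervals t i).card ≠ 0 := by
      rw [Finset.card_ne_zero, Finset.sdiff_nonempty]
      exact fun h2 => hne (eq_of_intervals_subset hc h2)
    omega
  · intro h
    exact rotates_or_rotates_of_card_sdiff hc hne (i := i) (by omega)

theorem card_le_and_exists_tree_of_noncrossing (m : ℕ) : ∀ (i : ℕ) (F : Finset (ℕ × ℕ)),
    (∀ a b, (a, b) ∈ F → i ≤ a ∧ a + 2 ≤ b ∧ b ≤ i + m + 1) →
    (∀ a b c d, (a, b) ∈ F → (c, d) ∈ F → ¬ (a < c ∧ c < b ∧ b < d)) →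
    F.card ≤ m ∧ (F.card = m → ∃ t : BinaryTree Unit, t.numNodes = m ∧ intervals t i = F) := by
  induction m using Nat.strong_induction_on with
  | _ m ih =>
    intro i F hF hcr
    rcases Nat.eq_zero_or_pos m with rfl | hm
    · have hF0 : F = ∅ := by
        rw [Finset.eq_empty_iff_forall_notMem]
        rintro ⟨a, b⟩ h
        have := hF a b h
        omega
      subst hF0
      exact ⟨by simp, fun _ => ⟨nil, rfl, rfl⟩⟩
    -- `k` is the root's split point: the largest right end of a proper interval starting at `i`, or
    -- `i + 1` (empty left subtree) if there is none. By noncrossing, every interval except the full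
    -- one lies on one side of `k`.
    · obtain ⟨k, hk1, hk2, hk3, hk4⟩ : ∃ k, i + 1 ≤ k ∧ k ≤ i + m ∧ (k = i + 1 ∨ (i, k) ∈ F) ∧
          ∀ b, (i, b) ∈ F → b ≤ i + m → b ≤ k := by
        obtain ⟨k, hk, hmax⟩ := Finset.exists_max_image
          (insert (i + 1) ((Finset.range (i + m + 1)).filter fun b => (i, b) ∈ F)) id
          ⟨i + 1, Finset.mem_insert_self _ _⟩
        simp only [Finset.mem_insert, Finset.mem_filter, Finset.mem_range, id] at hk hmax
        refine ⟨k, hmax _ (Or.inl rfl), ?_, hk.imp id And.right,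
          fun b hb hb' => hmax b (Or.inr ⟨by omega, hb⟩)⟩
        rcases hk with hk | hk <;> omega
      set L := F.filter fun p => p.2 ≤ k with hL
      set R := F.filter fun p => k ≤ p.1 with hR
      have hsub : ∀ a b, (a, b) ∈ F → (a = i ∧ b = i + m + 1) ∨ b ≤ k ∨ k ≤ a := by
        intro a b h
        have h1 := hF a b h
        by_contra hcon
        rcases Nat.eq_or_lt_of_le h1.1 with h2 | h2
        · subst h2
          have := hk4 b h
          omega
        · rcases hk3 with h3 | h3
          · omega
          · exact hcr _ _ _ _ h3 h (by omega)
      have hFsub : F ⊆ insert (i, i + m + 1) (L ∪ R) := by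
        rintro ⟨a, b⟩ h
        simp only [hL, hR, Finset.mem_insert, Finset.mem_union, Finset.mem_filter, h, true_and,
          Prod.mk.injEq]
        exact hsub a b h
      have hLi := ih (k - i - 1) (by omega) i L
        (fun a b h => by
          have := hF a b (Finset.mem_filter.1 h).1
          have := (Finset.mem_filter.1 h).2
          simp only at this
          omega)
        (fun a b c d h h' => hcr a b c d (Finset.mem_filter.1 h).1 (Finset.mem_filter.1 h').1)
      have hRi := ih (i + m - k) (by omega) k R
        (fun a b h => by
          have := hF a b (Finset.mem_filter.1 h).1
          have := (Finset.mem_filter.1 h).2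
          simp only at this
          omega)
        (fun a b c d h h' => hcr a b c d (Finset.mem_filter.1 h).1 (Finset.mem_filter.1 h').1)
      have hc1 := Finset.card_le_card hFsub
      have hc2 := Finset.card_insert_le (i, i + m + 1) (L ∪ R)
      have hc3 := Finset.card_union_le L R
      refine ⟨by omega, fun hcard => ?_⟩
      obtain ⟨l, hl, hl'⟩ := hLi.2 (by omega)
      obtain ⟨r, hr, hr'⟩ := hRi.2 (by omega)
      refine ⟨l △ r, by simp only [numNodes]; omega, ?_⟩
      have hroot : (i, i + m + 1) ∈ F := by
        by_contra hn
        have : F ⊆ L ∪ R := by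
          intro p hp
          rcases Finset.mem_insert.1 (hFsub hp) with h | h
          · exact absurd (h ▸ hp) hn
          · exact h
        have := Finset.card_le_card this
        omega
      rw [intervals, hl', hl, hr, show i + (k - i - 1) + 1 = k by omega, hr',
        show i + (k - i - 1) + (i + m - k) + 2 = i + m + 1 by omega]
      refine Finset.Subset.antisymm ?_ hFsub
      intro p hp
      rcases Finset.mem_insert.1 hp with h | h
      · rwa [h]
      · rcases Finset.mem_union.1 h with h | h
        · exact (Finset.mem_filter.1 h).1
        · exact (Finset.mem_filter.1 h).1

/-! ### The rotation graph is the flip graph -/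

/-- The sum of the sizes of all right subtrees; it grows under right rotations. -/
def rightWeight : BinaryTree Unit → ℕ
  | .nil => 0
  | .node _ l r => rightWeight l + rightWeight r + r.numNodes

theorem Rotates.rightWeight_lt {s t : BinaryTree Unit} (h : Rotates s t) :
    rightWeight s < rightWeight t := by
  induction h with
  | root a b c => simp only [rightWeight, numNodes]; omega
  | left r _ ih => simp only [rightWeight]; omega
  | right l h ih =>
    have := h.numNodes_eq
    simp only [rightWeight]; omega

/-- The rotation graph on binary trees with `m` nodes. -/
def treeGraph (m : ℕ) : SimpleGraph (treesOfNumNodesEq m) where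
  Adj s t := Rotates s t ∨ Rotates t s
  symm := ⟨fun _ _ h => h.symm⟩
  loopless := ⟨fun s h => by
    rcases h with h | h <;> exact lt_irrefl _ h.rightWeight_lt⟩

noncomputable instance (m : ℕ) : DecidableRel (treeGraph m).Adj := Classical.decRel _

/-- The diagonals of the `n`-gon corresponding to the proper subtrees of a binary tree. -/
def diagonals (n : ℕ) (t : BinaryTree Unit) : Finset (Fin n × Fin n) :=
  Finset.univ.filter fun d =>
    (d.1.val, d.2.val) ∈ intervals t 0 ∧ ¬ (d.1.val = 0 ∧ d.2.val + 1 = n)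

theorem image_diagonals {m : ℕ} {t : BinaryTree Unit} (ht : t.numNodes = m) :
    (diagonals (m + 2) t).image (fun d => (d.1.val, d.2.val)) =
      (intervals t 0).erase (0, m + 1) := by
  ext ⟨a, b⟩
  simp only [diagonals, Finset.mem_image, Finset.mem_filter, Finset.mem_univ, true_and,
    Finset.mem_erase, Prod.mk.injEq, Prod.exists, ne_eq]
  constructor
  · rintro ⟨x, y, ⟨h1, h2⟩, rfl, rfl⟩
    exact ⟨by omega, h1⟩
  · rintro ⟨h1, h2⟩
    have := bounds_of_mem_intervals h2
    exact ⟨⟨a, by omega⟩, ⟨b, by omega⟩, ⟨h2, by simp only; omega⟩, rfl, rfl⟩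

theorem fin_prod_val_injective (n : ℕ) :
    Function.Injective (fun d : Fin n × Fin n => (d.1.val, d.2.val)) := by
  rintro ⟨a, b⟩ ⟨c, d⟩ h
  simp only [Prod.mk.injEq] at h
  ext <;> simp [h]

theorem root_mem_intervals_zero {m : ℕ} (hm : 1 ≤ m) {t : BinaryTree Unit}
    (ht : t.numNodes = m) : (0, m + 1) ∈ intervals t 0 := by
  have := root_mem_intervals (t := t) 0 (by omega)
  rwa [ht, zero_add] at this

theorem card_diagonals_inter {m : ℕ} (hm : 1 ≤ m) {s t : BinaryTree Unit}
    (hs : s.numNodes = m) (ht : t.numNodes = m) :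
    (diagonals (m + 2) s ∩ diagonals (m + 2) t).card + 1 =
      (intervals s 0 ∩ intervals t 0).card := by
  rw [← Finset.card_image_of_injective _ (fin_prod_val_injective (m + 2)),
    Finset.image_inter _ _ (fin_prod_val_injective (m + 2)), image_diagonals hs,
    image_diagonals ht, Finset.erase_inter, Finset.inter_erase, Finset.erase_idem,
    Finset.card_erase_add_one]
  exact Finset.mem_inter.2 ⟨root_mem_intervals_zero hm hs, root_mem_intervals_zero hm ht⟩

/-- The triangulation dual to a binary tree. -/
def triangulationOfTree {m : ℕ} (hm : 1 ≤ m) (t : treesOfNumNodesEq m) :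
    Triangulation (m + 2) :=
  ⟨diagonals (m + 2) t, by
    have ht := mem_treesOfNumNodesEq.1 t.2
    refine ⟨fun d hd => ?_, fun d hd e he => ?_, ?_⟩
    · rw [diagonals, Finset.mem_filter] at hd
      exact ⟨(bounds_of_mem_intervals hd.2.1).2.1, hd.2.2⟩
    · rw [diagonals, Finset.mem_filter] at hd he
      rintro (h | h)
      · exact not_crossing_of_mem_intervals hd.2.1 he.2.1 h
      · exact not_crossing_of_mem_intervals he.2.1 hd.2.1 h
    · have := card_diagonals_inter hm ht ht
      rw [Finset.inter_self, Finset.inter_self, card_intervals, ht] at this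
      omega⟩

/-- Adding the side `(0, m + 1)` as root interval to the `m - 1` diagonals gives `m` noncrossing
intervals, the extremal case of `card_le_and_exists_tree_of_noncrossing`. -/
theorem bijective_triangulationOfTree {m : ℕ} (hm : 1 ≤ m) :
    Function.Bijective (triangulationOfTree hm) := by
  constructor
  · intro s t h
    have hs := mem_treesOfNumNodesEq.1 s.2
    have ht := mem_treesOfNumNodesEq.1 t.2
    have h1 : diagonals (m + 2) s = diagonals (m + 2) t := congrArg Subtype.val h
    have h2 := congrArg (Finset.image fun d : Fin (m + 2) × Fin (m + 2) => (d.1.val, d.2.val)) h1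
    rw [image_diagonals hs, image_diagonals ht] at h2
    apply Subtype.ext
    refine eq_of_intervals_subset (i := 0) (by rw [hs, ht]) ?_
    rw [← Finset.insert_erase (root_mem_intervals_zero hm hs), h2,
      Finset.insert_erase (root_mem_intervals_zero hm ht)]
  · rintro ⟨T, hd, hcr, hcard⟩
    set F := insert (0, m + 1) (T.image fun d => (d.1.val, d.2.val)) with hFdef
    have hroot : (0, m + 1) ∉ T.image fun d => (d.1.val, d.2.val) := by
      intro h
      obtain ⟨d, hdT, h⟩ := Finset.mem_image.1 h
      have := hd d hdT
      simp only [IsDiagonal, Prod.mk.injEq] at this h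
      omega
    have hmem : ∀ a b, (a, b) ∈ F → (a = 0 ∧ b = m + 1) ∨
        ∃ (ha : a < m + 2) (hb : b < m + 2), ((⟨a, ha⟩, ⟨b, hb⟩) : Fin (m + 2) × Fin (m + 2)) ∈ T := by
      intro a b h
      rcases Finset.mem_insert.1 h with h | h
      · exact Or.inl (by simpa using h)
      · obtain ⟨⟨x, y⟩, hdT, h⟩ := Finset.mem_image.1 h
        simp only [Prod.mk.injEq] at h
        obtain ⟨rfl, rfl⟩ := h
        exact Or.inr ⟨x.2, y.2, hdT⟩
    obtain ⟨t, ht, htF⟩ := (card_le_and_exists_tree_of_noncrossing m 0 F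
      (fun a b h => by
        rcases hmem a b h with h | ⟨ha, hb, h⟩
        · omega
        · have := (hd _ h).1
          simp only at this
          omega)
      (fun a b c d h h' hlt => by
        rcases hmem a b h with h | ⟨ha, hb, h⟩ <;> rcases hmem c d h' with h' | ⟨hc, hd, h'⟩
        · omega
        · omega
        · omega
        · exact hcr _ h _ h' (Or.inl ⟨hlt.1, hlt.2.1, hlt.2.2⟩))).2
      (by
        rw [hFdef, Finset.card_insert_of_notMem hroot,
          Finset.card_image_of_injective _ (fin_prod_val_injective (m + 2)), hcard]
        omega)
    refine ⟨⟨t, mem_treesOfNumNodesEq.2 ht⟩, Subtype.ext ?_⟩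
    apply Finset.image_injective (fin_prod_val_injective (m + 2))
    change (diagonals (m + 2) t).image _ = _
    rw [image_diagonals ht, htF, hFdef, Finset.erase_insert hroot]

/-- Binary trees under rotation are triangulations under flips. -/
noncomputable def treeGraphIso {m : ℕ} (hm : 2 ≤ m) : treeGraph m ≃g graph (m + 2) where
  toEquiv := Equiv.ofBijective _ (bijective_triangulationOfTree (by omega : 1 ≤ m))
  map_rel_iff' := by
    intro s t
    have hs := mem_treesOfNumNodesEq.1 s.2
    have ht := mem_treesOfNumNodesEq.1 t.2
    have hcard := card_diagonals_inter (by omega : 1 ≤ m) hs ht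
    simp only [Equiv.ofBijective_apply]
    change (triangulationOfTree _ s ≠ triangulationOfTree _ t ∧
      (diagonals (m + 2) s ∩ diagonals (m + 2) t).card = m + 2 - 4) ↔ (Rotates s t ∨ Rotates t s)
    rw [(bijective_triangulationOfTree _).1.ne_iff]
    constructor
    · rintro ⟨hne, h⟩
      rw [rotates_or_rotates_iff (i := 0) (by rw [hs, ht]) (Subtype.coe_injective.ne hne)]
      omega
    · intro h
      have hne : (s : BinaryTree Unit) ≠ t := by
        intro he
        rw [he] at h
        rcases h with h | h <;> exact lt_irrefl _ h.rightWeight_lt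
      rw [rotates_or_rotates_iff (i := 0) (by rw [hs, ht]) hne] at h
      exact ⟨fun h => hne (congrArg Subtype.val h), by omega⟩

theorem lambdaMin_eq {m : ℕ} (hm : 2 ≤ m) : lambdaMin (m + 2) = (treeGraph m).smallestEigenvalue :=
  (SimpleGraph.smallestEigenvalue_congr _ _ (treeGraphIso hm)).symm

/-! ### The rotation form on functions on trees of all sizes -/

/-- The right rotations of a binary tree. -/
def rotations : BinaryTree Unit → List (BinaryTree Unit)
  | .nil => []
  | .node _ l r => (rotations l).map (fun l' => l' △ r) ++ (rotations r).map (fun r' => l △ r') ++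
      (match l with
        | .nil => []
        | .node _ a b => [a △ b △ r])

theorem mem_rotations {s t : BinaryTree Unit} : t ∈ rotations s ↔ Rotates s t := by
  constructor
  · intro h
    induction s using unitRecOn generalizing t with
    | base => simp [rotations] at h
    | ind l r ihl ihr =>
      simp only [rotations, List.mem_append, List.mem_map] at h
      rcases h with (⟨l', h, rfl⟩ | ⟨r', h, rfl⟩) | h
      · exact Rotates.left r (ihl h)
      · exact Rotates.right l (ihr h)
      · cases l with
        | nil => simp at h
        | node _ a b =>
          simp only [List.mem_singleton] at h
          rw [h]
          exact Rotates.root a b r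
  · intro h
    induction h with
    | root a b c => simp [rotations]
    | left r _ ih => simp [rotations, ih]
    | right l _ ih => simp [rotations, ih]

theorem nodup_rotations (t : BinaryTree Unit) : (rotations t).Nodup := by
  induction t using unitRecOn with
  | base => simp [rotations]
  | ind l r ihl ihr =>
    rw [rotations.eq_def]
    dsimp only
    rw [List.nodup_append, List.nodup_append]
    refine ⟨⟨ihl.map fun a b h => by simpa using h, ihr.map fun a b h => by simpa using h, ?_⟩,
      ?_, ?_⟩
    · intro s hs t ht h
      obtain ⟨l', hl', rfl⟩ := List.mem_map.1 hs
      obtain ⟨r', hr', rfl⟩ := List.mem_map.1 ht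
      have := (mem_rotations.1 hl').rightWeight_lt
      simp only [node.injEq, true_and] at h
      rw [h.1] at this
      exact lt_irrefl _ this
    · cases l <;> simp
    · intro s hs t ht h
      cases l with
      | nil => simp at ht
      | node _ a b =>
        simp only [List.mem_singleton] at ht
        rw [List.mem_append] at hs
        rcases hs with hs | hs
        · obtain ⟨l', -, rfl⟩ := List.mem_map.1 hs
          rw [ht, node.injEq] at h
          have := congrArg numNodes h.2.2
          simp only [numNodes] at this
          omega
        · obtain ⟨r', -, rfl⟩ := List.mem_map.1 hs
          rw [ht, node.injEq] at h
          have := congrArg numNodes h.2.1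
          simp only [numNodes] at this
          omega

/-- The binary trees with at most `N` nodes. -/
def treesUpTo (N : ℕ) : Finset (BinaryTree Unit) :=
  (Finset.range (N + 1)).biUnion treesOfNumNodesEq

theorem mem_treesUpTo {N : ℕ} {t : BinaryTree Unit} : t ∈ treesUpTo N ↔ t.numNodes ≤ N := by
  simp [treesUpTo, mem_treesOfNumNodesEq]

/-- The pairs `(l, r)` range over a full product, including trees `l △ r` with more than `N` nodes;
these contribute nothing. This is what lets later sums factor. -/
theorem sum_treesUpTo {N : ℕ} {F : BinaryTree Unit → ℝ}
    (hF : ∀ t : BinaryTree Unit, N < t.numNodes → F t = 0) :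
    ∑ t ∈ treesUpTo N, F t =
      F nil + ∑ l ∈ treesUpTo N, ∑ r ∈ treesUpTo N, F (l △ r) := by
  classical
  have hsub : treesUpTo N ⊆ insert nil
      ((treesUpTo N ×ˢ treesUpTo N).image fun p => p.1 △ p.2) := by
    intro t ht
    cases t with
    | nil => exact Finset.mem_insert_self _ _
    | node _ l r =>
      rw [mem_treesUpTo, numNodes] at ht
      refine Finset.mem_insert_of_mem (Finset.mem_image.2 ⟨(l, r), ?_, rfl⟩)
      simp only [Finset.mem_product, mem_treesUpTo]
      omega
  rw [Finset.sum_subset hsub (fun t _ ht => hF t (by rw [mem_treesUpTo] at ht; omega)),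
    Finset.sum_insert (by simp), Finset.sum_image (by
      rintro ⟨a, b⟩ _ ⟨c, d⟩ _ h
      simpa using h), Finset.sum_product]

/-- The sum of `x` over the right rotations of `t`. -/
def rotSum (x : BinaryTree Unit → ℝ) (t : BinaryTree Unit) : ℝ := ((rotations t).map x).sum

theorem rotSum_nil (x : BinaryTree Unit → ℝ) : rotSum x nil = 0 := by simp [rotSum, rotations]

theorem rotSum_nil_node (x : BinaryTree Unit → ℝ) (r : BinaryTree Unit) :
    rotSum x (nil △ r) = rotSum (fun r' => x (nil △ r')) r := by
  simp [rotSum, rotations, Function.comp_def]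

theorem rotSum_node_node (x : BinaryTree Unit → ℝ) (a b r : BinaryTree Unit) :
    rotSum x ((a △ b) △ r) = rotSum (fun l => x (l △ r)) (a △ b) +
      rotSum (fun r' => x ((a △ b) △ r')) r + x (a △ b △ r) := by
  rw [rotSum, rotations]
  simp [rotSum, Function.comp_def, add_assoc]

/-- The quadratic form of the rotation graph, on functions on trees with at most `N` nodes. -/
noncomputable def rotForm (N : ℕ) (x : BinaryTree Unit → ℝ) : ℝ :=
  2 * ∑ t ∈ treesUpTo N, x t * rotSum x t

/-- A rotation takes place inside the left subtree, inside the right subtree, or at the root. The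
form is stated for all sizes at once so that it applies to the slices `fun l => x (l △ r)`, whose
supports mix sizes. -/
theorem rotForm_eq {N : ℕ} {x : BinaryTree Unit → ℝ}
    (hx : ∀ t : BinaryTree Unit, N < t.numNodes → x t = 0) :
    rotForm N x = ∑ r ∈ treesUpTo N, rotForm N (fun l => x (l △ r)) +
      ∑ l ∈ treesUpTo N, rotForm N (fun r => x (l △ r)) +
      2 * ∑ a ∈ treesUpTo N, ∑ b ∈ treesUpTo N, ∑ c ∈ treesUpTo N,
        x ((a △ b) △ c) * x (a △ b △ c) := by
  have h1 : rotForm N x = 2 * ∑ l ∈ treesUpTo N, ∑ r ∈ treesUpTo N,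
      x (l △ r) * rotSum x (l △ r) := by
    rw [rotForm, sum_treesUpTo (fun t ht => by rw [hx t ht, zero_mul]), rotSum_nil, mul_zero,
      zero_add]
  have h2 : ∑ l ∈ treesUpTo N, ∑ r ∈ treesUpTo N, (x (l △ r) * rotSum x (l △ r) -
      x (l △ r) * rotSum (fun l => x (l △ r)) l - x (l △ r) * rotSum (fun r => x (l △ r)) r) =
      ∑ a ∈ treesUpTo N, ∑ b ∈ treesUpTo N, ∑ c ∈ treesUpTo N,
        x ((a △ b) △ c) * x (a △ b △ c) := by
    rw [sum_treesUpTo (fun t ht => Finset.sum_eq_zero fun r _ => by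
      rw [hx (t △ r) (by simp only [numNodes]; omega)]; ring)]
    rw [Finset.sum_eq_zero (fun r _ => by rw [rotSum_nil_node, rotSum_nil]; ring), zero_add]
    refine Finset.sum_congr rfl fun a _ => Finset.sum_congr rfl fun b _ =>
      Finset.sum_congr rfl fun c _ => ?_
    rw [rotSum_node_node]
    ring
  rw [h1, ← h2]
  simp only [rotForm, Finset.sum_sub_distrib, ← Finset.mul_sum]
  rw [Finset.sum_comm (f := fun l r => x (l △ r) * rotSum (fun l => x (l △ r)) l)]
  ring

theorem sum_treesUpTo_eq_sum_range (N : ℕ) (F : BinaryTree Unit → ℝ) :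
    ∑ t ∈ treesUpTo N, F t = ∑ m ∈ Finset.range (N + 1), ∑ t : treesOfNumNodesEq m, F t := by
  rw [treesUpTo, Finset.sum_biUnion]
  · refine Finset.sum_congr rfl fun m _ => ?_
    exact (Finset.sum_coe_sort _ _).symm
  · intro i _ j _ hij
    rw [Function.onFun, Finset.disjoint_left]
    intro t hi hj
    exact hij ((mem_treesOfNumNodesEq.1 hi).symm.trans (mem_treesOfNumNodesEq.1 hj))

theorem sum_rotates {m : ℕ} (x : BinaryTree Unit → ℝ) (s : treesOfNumNodesEq m) :
    (∑ t : treesOfNumNodesEq m, open Classical in if Rotates s t then x t else 0) =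
      rotSum x s := by
  classical
  rw [Finset.sum_coe_sort (treesOfNumNodesEq m) (fun t => if Rotates s t then x t else 0),
    ← Finset.sum_filter, rotSum, ← List.sum_toFinset _ (nodup_rotations _)]
  refine Finset.sum_congr ?_ fun _ _ => rfl
  ext t
  simp only [Finset.mem_filter, List.mem_toFinset, mem_rotations, mem_treesOfNumNodesEq,
    and_iff_right_iff_imp]
  intro h
  rw [← h.numNodes_eq]
  exact mem_treesOfNumNodesEq.1 s.2

theorem sum_adj_eq {m : ℕ} (x : BinaryTree Unit → ℝ) :
    (∑ s : treesOfNumNodesEq m, x s *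
      ∑ t : treesOfNumNodesEq m, if (treeGraph m).Adj s t then x t else 0) =
      2 * ∑ s : treesOfNumNodesEq m, x s * rotSum x s := by
  classical
  have h : ∀ s t : treesOfNumNodesEq m, (if (treeGraph m).Adj s t then x t else 0) =
      (if Rotates s t then x t else 0) + (if Rotates t s then x t else 0) := by
    intro s t
    have h1 : (treeGraph m).Adj s t ↔ Rotates s t ∨ Rotates t s := Iff.rfl
    have h2 : Rotates s t → ¬ Rotates t s := fun h h' =>
      lt_asymm h.rightWeight_lt h'.rightWeight_lt
    by_cases h3 : Rotates s t
    · simp [h1, h3, h2 h3]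
    · simp [h1, h3]
  have h2 : ∑ s : treesOfNumNodesEq m, ∑ t : treesOfNumNodesEq m,
      x s * (if Rotates t s then x t else 0) = ∑ s : treesOfNumNodesEq m, x s * rotSum x s := by
    rw [Finset.sum_comm]
    refine Finset.sum_congr rfl fun s _ => ?_
    rw [← sum_rotates, Finset.mul_sum]
    refine Finset.sum_congr rfl fun t _ => ?_
    split_ifs <;> ring
  simp only [h, Finset.sum_add_distrib, mul_add, Finset.mul_sum] at h2 ⊢
  rw [h2, ← Finset.mul_sum, two_mul]
  congr 1
  refine Finset.sum_congr rfl fun s _ => ?_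
  rw [← sum_rotates, Finset.mul_sum]

instance (m : ℕ) : Nonempty (treesOfNumNodesEq m) := by
  induction m with
  | zero => exact ⟨⟨nil, by simp⟩⟩
  | succ m ih =>
    obtain ⟨t, ht⟩ := ih
    rw [mem_treesOfNumNodesEq] at ht
    exact ⟨⟨nil △ t, by simp [mem_treesOfNumNodesEq, ht]⟩⟩

/-- The smallest eigenvalue of the rotation graph on trees with `m` nodes. -/
noncomputable def treeMin (m : ℕ) : ℝ := (treeGraph m).smallestEigenvalue

/-- Rotations preserve the number of nodes, so the form is block diagonal by size and the Rayleigh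
bound applies to each block. -/
theorem sum_treeMin_mul_sq_le_rotForm (N : ℕ) (x : BinaryTree Unit → ℝ) :
    ∑ t ∈ treesUpTo N, treeMin t.numNodes * x t ^ 2 ≤ rotForm N x := by
  rw [rotForm, sum_treesUpTo_eq_sum_range, sum_treesUpTo_eq_sum_range, Finset.mul_sum]
  refine Finset.sum_le_sum fun m _ => ?_
  rw [← sum_adj_eq]
  refine le_trans (le_of_eq ?_)
    ((treeGraph m).smallestEigenvalue_mul_sum_sq_le fun t => x t)
  rw [Finset.mul_sum]
  refine Finset.sum_congr rfl fun t _ => ?_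
  rw [mem_treesOfNumNodesEq.1 t.2, treeMin]

/-- The least eigenfunction, extended by zero to trees of other sizes. -/
theorem exists_rotForm_eq_treeMin (m : ℕ) : ∃ x : BinaryTree Unit → ℝ,
    (∀ t : BinaryTree Unit, t.numNodes ≠ m → x t = 0) ∧ ∀ N, m ≤ N →
      0 < ∑ t ∈ treesUpTo N, x t ^ 2 ∧
      rotForm N x = treeMin m * ∑ t ∈ treesUpTo N, x t ^ 2 := by
  classical
  obtain ⟨y, hy0, hy⟩ := (treeGraph m).exists_smallestEigenvalue_eigenfunction
  set x : BinaryTree Unit → ℝ := fun t =>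
    if h : t ∈ treesOfNumNodesEq m then y ⟨t, h⟩ else 0 with hx
  have hxy : ∀ t : treesOfNumNodesEq m, x t = y t := fun t => by simp only [hx, dif_pos t.2]
  have hx0 : ∀ t : BinaryTree Unit, t.numNodes ≠ m → x t = 0 := by
    intro t ht
    simp only [hx, dif_neg (fun h => ht (mem_treesOfNumNodesEq.1 h))]
  refine ⟨x, hx0, fun N hN => ?_⟩
  have hsum : ∀ F : BinaryTree Unit → ℝ, ∑ t ∈ treesUpTo N, x t * F t =
      ∑ t : treesOfNumNodesEq m, x t * F t := by
    intro F
    rw [sum_treesUpTo_eq_sum_range]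
    refine Finset.sum_eq_single m (fun k _ hk => Finset.sum_eq_zero fun t _ => ?_)
      (fun h => absurd (Finset.mem_range.2 (by omega)) h)
    rw [hx0 t (by rw [mem_treesOfNumNodesEq.1 t.2]; exact hk), zero_mul]
  simp only [pow_two]
  rw [rotForm, hsum, hsum, ← sum_adj_eq]
  constructor
  · obtain ⟨i, hi⟩ := Function.ne_iff.1 hy0
    refine Finset.sum_pos' (fun t _ => mul_self_nonneg _) ⟨i, Finset.mem_univ _, ?_⟩
    rw [hxy]
    exact mul_self_pos.2 hi
  · simp only [hxy, hy, treeMin, Finset.mul_sum]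
    refine Finset.sum_congr rfl fun t _ => ?_
    ring

/-! ### Grafting and subadditivity -/

/-- The function on trees with value `c` at the empty tree and `u l * w r` at `l △ r`. -/
def graft (c : ℝ) (u w : BinaryTree Unit → ℝ) : BinaryTree Unit → ℝ
  | .nil => c
  | .node _ l r => u l * w r

theorem rotForm_const_mul (N : ℕ) (c : ℝ) (x : BinaryTree Unit → ℝ) :
    rotForm N (fun t => c * x t) = c ^ 2 * rotForm N x := by
  have h : ∀ t, rotSum (fun t => c * x t) t = c * rotSum x t := fun t => by
    rw [rotSum, rotSum, List.sum_map_mul_left]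
  simp only [rotForm, h, Finset.mul_sum]
  exact Finset.sum_congr rfl fun t _ => by ring

theorem rotForm_graft {N : ℕ} {c : ℝ} {u w : BinaryTree Unit → ℝ}
    (h : ∀ t : BinaryTree Unit, N < t.numNodes → graft c u w t = 0) :
    rotForm N (graft c u w) = rotForm N u * ∑ t ∈ treesUpTo N, w t ^ 2 +
      (∑ t ∈ treesUpTo N, u t ^ 2) * rotForm N w +
      2 * ∑ a ∈ treesUpTo N, ∑ b ∈ treesUpTo N, ∑ d ∈ treesUpTo N,
        (u (a △ b) * u a) * (w d * w (b △ d)) := by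
  rw [rotForm_eq h]
  congr 1
  · congr 1
    · rw [Finset.mul_sum]
      refine Finset.sum_congr rfl fun r _ => ?_
      simp only [graft, mul_comm (u _) (w r), rotForm_const_mul]
      ring
    · rw [Finset.sum_mul]
      refine Finset.sum_congr rfl fun l _ => ?_
      simp only [graft, rotForm_const_mul]
  · congr 1
    refine Finset.sum_congr rfl fun a _ => Finset.sum_congr rfl fun b _ =>
      Finset.sum_congr rfl fun d _ => ?_
    simp only [graft]
    ring

theorem sum_sq_graft {N : ℕ} {c : ℝ} {u w : BinaryTree Unit → ℝ}
    (h : ∀ t : BinaryTree Unit, N < t.numNodes → graft c u w t = 0) :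
    ∑ t ∈ treesUpTo N, graft c u w t ^ 2 =
      c ^ 2 + (∑ t ∈ treesUpTo N, u t ^ 2) * ∑ t ∈ treesUpTo N, w t ^ 2 := by
  rw [sum_treesUpTo (fun t ht => by rw [h t ht]; ring), Finset.sum_mul_sum]
  simp only [graft, mul_pow]

theorem treeMin_add_le (i j : ℕ) : treeMin (i + j + 1) ≤ treeMin i + treeMin j := by
  obtain ⟨u, hu0, hu⟩ := exists_rotForm_eq_treeMin i
  obtain ⟨w, hw0, hw⟩ := exists_rotForm_eq_treeMin j
  set N := i + j + 1
  obtain ⟨hu1, hu2⟩ := hu N (by omega)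
  obtain ⟨hw1, hw2⟩ := hw N (by omega)
  have hx0 : ∀ t : BinaryTree Unit, t.numNodes ≠ N → graft 0 u w t = 0 := by
    intro t ht
    cases t with
    | nil => rfl
    | node _ l r =>
      simp only [graft]
      by_cases hl : l.numNodes = i
      · rw [hw0 r (by simp only [numNodes] at ht; omega), mul_zero]
      · rw [hu0 l hl, zero_mul]
  have hx : ∀ t : BinaryTree Unit, N < t.numNodes → graft 0 u w t = 0 :=
    fun t ht => hx0 t ht.ne'
  have h := sum_treeMin_mul_sq_le_rotForm N (graft 0 u w)
  have h1 : ∑ t ∈ treesUpTo N, treeMin t.numNodes * graft 0 u w t ^ 2 =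
      treeMin N * ∑ t ∈ treesUpTo N, graft 0 u w t ^ 2 := by
    rw [Finset.mul_sum]
    refine Finset.sum_congr rfl fun t _ => ?_
    by_cases ht : t.numNodes = N
    · rw [ht]
    · rw [hx0 t ht]; ring
  -- Root rotations change the size of the left subtree, while `u` is supported on a single size.
  have h2 : ∑ a ∈ treesUpTo N, ∑ b ∈ treesUpTo N, ∑ d ∈ treesUpTo N,
        (u (a △ b) * u a) * (w d * w (b △ d)) = 0 := by
    refine Finset.sum_eq_zero fun a _ => Finset.sum_eq_zero fun b _ =>
      Finset.sum_eq_zero fun d _ => ?_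
    by_cases ha : a.numNodes = i
    · rw [hu0 (a △ b) (by simp only [numNodes]; omega)]; ring
    · rw [hu0 a ha]; ring
  rw [h1, rotForm_graft hx, sum_sq_graft hx, h2, hu2, hw2] at h
  have hpos := mul_pos hu1 hw1
  refine le_of_mul_le_mul_right ?_ hpos
  nlinarith

/-! ### The spine test function and the constant 0.6904 -/

/-- The weights of the subtrees hanging off the spine in the test function. -/
noncomputable def blockWeight : BinaryTree Unit → ℝ
  | .nil => 14 / 17
  | .node _ .nil .nil => -9 / 17
  | .node _ (.node _ .nil .nil) .nil => 2 / 17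
  | .node _ .nil (.node _ .nil .nil) => 2 / 17
  | .node _ (.node _ .nil .nil) (.node _ .nil .nil) => -2 / 17
  | _ => 0

theorem blockWeight_ne_zero {t : BinaryTree Unit} (h : blockWeight t ≠ 0) :
    t ∈ ({nil, nil △ nil, (nil △ nil) △ nil, nil △ nil △ nil,
      (nil △ nil) △ nil △ nil} : Finset (BinaryTree Unit)) := by
  unfold blockWeight at h
  split at h <;> simp_all

theorem sum_blockWeight_mul {N : ℕ} (hN : 3 ≤ N) (F : BinaryTree Unit → ℝ) :
    ∑ t ∈ treesUpTo N, blockWeight t * F t = 14 / 17 * F nil - 9 / 17 * F (nil △ nil) +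
      2 / 17 * F ((nil △ nil) △ nil) + 2 / 17 * F (nil △ nil △ nil) -
      2 / 17 * F ((nil △ nil) △ nil △ nil) := by
  rw [← Finset.sum_subset (s₁ := {nil, nil △ nil, (nil △ nil) △ nil, nil △ nil △ nil,
      (nil △ nil) △ nil △ nil})]
  · rw [Finset.sum_insert (by simp), Finset.sum_insert (by simp), Finset.sum_insert (by simp),
      Finset.sum_insert (by simp), Finset.sum_singleton]
    simp only [blockWeight]
    ring
  · intro t ht
    simp only [Finset.mem_insert, Finset.mem_singleton] at ht
    rw [mem_treesUpTo]
    rcases ht with rfl | rfl | rfl | rfl | rfl <;> simp only [numNodes] <;> omega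
  · intro t _ ht
    by_contra h
    exact ht (blockWeight_ne_zero (left_ne_zero_of_mul h))

theorem blockWeight_eq_zero {t : BinaryTree Unit} (ht : 3 < t.numNodes) : blockWeight t = 0 := by
  by_contra h
  have := blockWeight_ne_zero h
  simp only [Finset.mem_insert, Finset.mem_singleton] at this
  rcases this with rfl | rfl | rfl | rfl | rfl <;> simp at ht

/-- The numerators satisfy `14² + 9² + 2² + 2² + 2² = 17²`. Normalization makes every spine length
up to `L` carry total mass `1`. -/
theorem sum_blockWeight_sq {N : ℕ} (hN : 3 ≤ N) : ∑ t ∈ treesUpTo N, blockWeight t ^ 2 = 1 := by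
  simp only [pow_two]
  rw [sum_blockWeight_mul hN]
  norm_num [blockWeight]

theorem sum_size_mul_blockWeight_sq {N : ℕ} (hN : 3 ≤ N) :
    ∑ t ∈ treesUpTo N, (t.numNodes + 1 : ℝ) * blockWeight t ^ 2 = 398 / 289 := by
  have : ∀ t : BinaryTree Unit, (t.numNodes + 1 : ℝ) * blockWeight t ^ 2 =
    blockWeight t * (blockWeight t * (t.numNodes + 1)) := fun t => by ring
  simp only [this]
  rw [sum_blockWeight_mul hN]
  norm_num [blockWeight]

/-- The only rotation inside the support joins the two trees with two nodes, giving `2 * (2/17)²`.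
-/
theorem rotForm_blockWeight {N : ℕ} (hN : 3 ≤ N) : rotForm N blockWeight = 8 / 289 := by
  rw [rotForm, sum_blockWeight_mul hN]
  norm_num [rotSum, rotations, blockWeight]

/-- The weights have sign `(-1)^size` and a merge adds one node, so every nonzero term is negative:
`-1764 - 2 * 252 - 162 = -2430`, over `17³`. -/
theorem sum_blockWeight_merge {N : ℕ} (hN : 3 ≤ N) :
    ∑ b ∈ treesUpTo N, ∑ d ∈ treesUpTo N,
      blockWeight b * (blockWeight d * blockWeight (b △ d)) = -2430 / 4913 := by
  simp only [← Finset.mul_sum]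
  simp only [sum_blockWeight_mul hN]
  norm_num [blockWeight]

/-- The test function: a product of block weights over the subtrees hanging off the left spine,
truncated to spines of length at most `L`. -/
noncomputable def spineWeight : ℕ → BinaryTree Unit → ℝ
  | 0 => graft 1 0 0
  | L + 1 => graft 1 (spineWeight L) blockWeight

theorem spineWeight_eq_zero {L : ℕ} {t : BinaryTree Unit} (ht : 4 * L < t.numNodes) :
    spineWeight L t = 0 := by
  induction L generalizing t with
  | zero =>
    cases t with
    | nil => simp at ht
    | node _ l r => simp [spineWeight, graft]
  | succ L ih =>
    cases t with
    | nil => simp at ht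
    | node _ l r =>
      simp only [spineWeight, graft]
      simp only [numNodes] at ht
      by_cases h : 3 < r.numNodes
      · rw [blockWeight_eq_zero h, mul_zero]
      · rw [ih (by omega), zero_mul]

/-- The two functions agree wherever `spineWeight L` is nonzero; raising `L` only admits longer
spines. -/
theorem spineWeight_mul_succ (L : ℕ) (t : BinaryTree Unit) :
    spineWeight L t * spineWeight (L + 1) t = spineWeight L t ^ 2 := by
  induction L generalizing t with
  | zero => cases t <;> simp [spineWeight, graft]
  | succ L ih =>
    cases t with
    | nil => simp [spineWeight, graft]
    | node _ l r =>
      have := ih l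
      rw [spineWeight, spineWeight]
      simp only [graft]
      linear_combination blockWeight r ^ 2 * this

theorem sum_spineWeight_sq {L N : ℕ} (hN : 4 * L ≤ N) :
    ∑ t ∈ treesUpTo N, spineWeight L t ^ 2 = L + 1 := by
  induction L with
  | zero =>
    rw [spineWeight, sum_sq_graft fun t ht => spineWeight_eq_zero (L := 0) (by omega)]
    simp
  | succ L ih =>
    rw [spineWeight, sum_sq_graft fun t ht => spineWeight_eq_zero (L := L + 1) (by omega),
      ih (by omega), sum_blockWeight_sq (by omega)]
    push_cast
    ring

/-- In leaves, a spine of length `ℓ` has mean size `1 + ℓ * 398/289`: one leaf at its tip plus the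
leaves of `ℓ` independent blocks. Sum over `ℓ ≤ L`. -/
theorem sum_size_mul_spineWeight_sq {L N : ℕ} (hN : 4 * L ≤ N) :
    ∑ t ∈ treesUpTo N, (t.numNodes + 1 : ℝ) * spineWeight L t ^ 2 =
      (L + 1) + 398 / 289 * (L * (L + 1) / 2) := by
  have hz : ∀ t : BinaryTree Unit, N < t.numNodes →
      (t.numNodes + 1 : ℝ) * spineWeight L t ^ 2 = 0 := fun t ht => by
    rw [spineWeight_eq_zero (by omega)]; ring
  induction L with
  | zero =>
    rw [sum_treesUpTo hz]
    simp [spineWeight, graft]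
  | succ L ih =>
    rw [sum_treesUpTo hz]
    have h : ∀ l r : BinaryTree Unit, ((l △ r).numNodes + 1 : ℝ) * spineWeight (L + 1) (l △ r) ^ 2 =
        ((l.numNodes + 1) * spineWeight L l ^ 2) * blockWeight r ^ 2 +
        spineWeight L l ^ 2 * ((r.numNodes + 1) * blockWeight r ^ 2) := by
      intro l r
      simp only [spineWeight, graft, numNodes]
      push_cast
      ring
    simp only [h, Finset.sum_add_distrib, ← Finset.sum_mul_sum]
    rw [sum_blockWeight_sq (by omega), sum_size_mul_blockWeight_sq (by omega),
      sum_spineWeight_sq (by omega), ih (by omega) fun t ht => by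
        rw [spineWeight_eq_zero (by omega)]; ring]
    simp only [spineWeight, graft, numNodes]
    push_cast
    ring

/-- A spine of length `ℓ` contributes `8/289` for rotations inside each of its `ℓ` blocks, and `2 *
(-2430/4913)` for merging each of its `ℓ - 1` neighbouring pairs. Sum over `ℓ ≤ L`. -/
theorem rotForm_spineWeight {L N : ℕ} (hN : 4 * L ≤ N) :
    rotForm N (spineWeight L) =
      8 / 289 * (L * (L + 1) / 2) - 2430 / 4913 * (L * (L - 1)) := by
  induction L with
  | zero =>
    have h : spineWeight 0 = graft 1 0 0 := rfl
    rw [h, rotForm_graft fun t ht => spineWeight_eq_zero (L := 0) (by omega)]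
    simp [rotForm]
  | succ L ih =>
    have h : spineWeight (L + 1) = graft 1 (spineWeight L) blockWeight := rfl
    have hcross : ∑ a ∈ treesUpTo N, ∑ b ∈ treesUpTo N, ∑ d ∈ treesUpTo N,
        (spineWeight L (a △ b) * spineWeight L a) * (blockWeight d * blockWeight (b △ d)) =
        L * (-2430 / 4913) := by
      cases L with
      | zero => simp [spineWeight, graft]
      | succ L =>
        have h' : ∀ a b d : BinaryTree Unit,
            (spineWeight (L + 1) (a △ b) * spineWeight (L + 1) a) *
              (blockWeight d * blockWeight (b △ d)) =
            spineWeight L a ^ 2 * (blockWeight b * (blockWeight d * blockWeight (b △ d))) := by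
          intro a b d
          rw [← spineWeight_mul_succ]
          have : spineWeight (L + 1) (a △ b) = spineWeight L a * blockWeight b := rfl
          rw [this]
          ring
        have h'' : ∑ a ∈ treesUpTo N, ∑ b ∈ treesUpTo N, ∑ d ∈ treesUpTo N,
            (spineWeight (L + 1) (a △ b) * spineWeight (L + 1) a) *
              (blockWeight d * blockWeight (b △ d)) =
            (∑ a ∈ treesUpTo N, spineWeight L a ^ 2) * ∑ b ∈ treesUpTo N, ∑ d ∈ treesUpTo N,
              blockWeight b * (blockWeight d * blockWeight (b △ d)) := by
          rw [Finset.sum_mul]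
          refine Finset.sum_congr rfl fun a _ => ?_
          simp only [Finset.mul_sum, h']
        rw [h'', sum_blockWeight_merge (by omega), sum_spineWeight_sq (by omega)]
        push_cast
        ring
    rw [h, rotForm_graft fun t ht => spineWeight_eq_zero (L := L + 1) (by omega), hcross,
      ih (by omega), sum_blockWeight_sq (by omega), rotForm_blockWeight (by omega),
      sum_spineWeight_sq (by omega)]
    push_cast
    ring

theorem exists_treeMin_lt : ∃ m : ℕ, treeMin m < -0.6904 * (m + 1) := by
  by_contra! h
  -- At `L = 400` the quotient is about `-0.692`, close enough to its limit `-0.698` to beat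
  -- `-0.6904`.
  have h1 := sum_treeMin_mul_sq_le_rotForm (4 * 400) (spineWeight 400)
  have h2 : -0.6904 * ∑ t ∈ treesUpTo (4 * 400), (t.numNodes + 1 : ℝ) * spineWeight 400 t ^ 2 ≤
      ∑ t ∈ treesUpTo (4 * 400), treeMin t.numNodes * spineWeight 400 t ^ 2 := by
    rw [Finset.mul_sum]
    refine Finset.sum_le_sum fun t _ => ?_
    rw [← mul_assoc]
    exact mul_le_mul_of_nonneg_right (h _) (sq_nonneg _)
  have h3 := h2.trans h1
  rw [rotForm_spineWeight le_rfl, sum_size_mul_spineWeight_sq le_rfl] at h3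
  norm_num at h3

/-! ### The lower bound from pentagons -/

open Real

/-- The least eigenvalue of the 5-cycle is `2 cos (4π/5) = -φ`, with multiplicity two. The shifted
form therefore has rank three and is a combination of three squares, with positive coefficients
because `φ > 1`. -/
theorem pentagon_form_nonneg (a b c d e : ℝ) :
    0 ≤ 2 * (a * b + b * c + c * d + d * e + e * a) +
      goldenRatio * (a ^ 2 + b ^ 2 + c ^ 2 + d ^ 2 + e ^ 2) := by
  have h := goldenRatio_sq
  have h1 := one_lt_goldenRatio
  set p := goldenRatio
  have key : 2 * (a * b + b * c + c * d + d * e + e * a) +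
      p * (a ^ 2 + b ^ 2 + c ^ 2 + d ^ 2 + e ^ 2) =
      p * (a + (p - 1) * (b + e)) ^ 2 + (b + c - (p - 1) * e) ^ 2 +
        (p - 1) * (c + e + p * d) ^ 2 := by
    have h3 : p ^ 3 = 2 * p + 1 := by linear_combination (p + 1) * h
    ring_nf
    rw [h3, h]
    ring
  rw [key]
  have : 0 ≤ p - 1 := by linarith
  positivity

/-- `1` at nonempty trees and `0` at the empty tree. -/
def nodeIndicator : BinaryTree Unit → ℝ
  | .nil => 0
  | .node _ _ _ => 1

/-- The number of nonempty children of the root. -/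
def childCount : BinaryTree Unit → ℝ
  | .nil => 0
  | .node _ l r => nodeIndicator l + nodeIndicator r

theorem sum_nodeIndicator_mul {N : ℕ} {F : BinaryTree Unit → ℝ}
    (hF : ∀ t : BinaryTree Unit, N < t.numNodes → F t = 0) :
    ∑ t ∈ treesUpTo N, nodeIndicator t * F t =
      ∑ l ∈ treesUpTo N, ∑ r ∈ treesUpTo N, F (l △ r) := by
  rw [sum_treesUpTo fun t ht => by rw [hF t ht, mul_zero]]
  simp [nodeIndicator]

theorem sum_childCount_mul {N : ℕ} {F : BinaryTree Unit → ℝ}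
    (hF : ∀ t : BinaryTree Unit, N < t.numNodes → F t = 0) :
    ∑ t ∈ treesUpTo N, childCount t * F t =
      (∑ a ∈ treesUpTo N, ∑ b ∈ treesUpTo N, ∑ c ∈ treesUpTo N, F ((a △ b) △ c)) +
      ∑ a ∈ treesUpTo N, ∑ b ∈ treesUpTo N, ∑ c ∈ treesUpTo N, F (a △ b △ c) := by
  rw [sum_treesUpTo fun t ht => by rw [hF t ht, mul_zero]]
  simp only [childCount, add_mul, Finset.sum_add_distrib, zero_mul, zero_add]
  congr 1
  · simp only [← Finset.mul_sum]
    exact sum_nodeIndicator_mul fun t ht => Finset.sum_eq_zero fun r _ =>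
      hF _ (by simp only [numNodes]; omega)
  · refine Finset.sum_congr rfl fun a _ => ?_
    exact sum_nodeIndicator_mul fun t ht => hF _ (by simp only [numNodes]; omega)

/-- The part of the rotation form coming from rotations at the root. -/
noncomputable def rootForm (N : ℕ) (x : BinaryTree Unit → ℝ) : ℝ :=
  2 * ∑ a ∈ treesUpTo N, ∑ b ∈ treesUpTo N, ∑ c ∈ treesUpTo N,
    x ((a △ b) △ c) * x (a △ b △ c)

/-- Apply `2xy ≥ -(x² + y²)` to each root rotation; a tree is an end of one such rotation for each
nonempty child of its root. -/
theorem neg_sum_childCount_le_rootForm {N : ℕ} {x : BinaryTree Unit → ℝ}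
    (hx : ∀ t : BinaryTree Unit, N < t.numNodes → x t = 0) :
    -∑ t ∈ treesUpTo N, childCount t * x t ^ 2 ≤ rootForm N x := by
  rw [sum_childCount_mul fun t ht => by rw [hx t ht]; ring, rootForm, neg_le_iff_add_nonneg]
  simp only [Finset.mul_sum, ← Finset.sum_add_distrib]
  refine Finset.sum_nonneg fun a _ => Finset.sum_nonneg fun b _ => Finset.sum_nonneg fun c _ => ?_
  nlinarith [sq_nonneg (x ((a △ b) △ c) + x (a △ b △ c))]

/-- The cost of the pentagons and unpaired rotations at the root of `l △ r`. -/
noncomputable def rootCost (l r : BinaryTree Unit) : ℝ :=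
  3 * (nodeIndicator l + nodeIndicator r) + (goldenRatio - 1) * (childCount l + childCount r) -
    (2 - goldenRatio) * (nodeIndicator l * nodeIndicator r)

/-- This turns the cost of a single tree into sums over configurations: the factor `3` goes with
ends of root rotations, `φ - 1` with the four unbalanced pentagon vertices, and `2 - φ` with the
balanced one. -/
theorem sum_rootCost_mul {N : ℕ} {x : BinaryTree Unit → ℝ}
    (hx : ∀ t : BinaryTree Unit, N < t.numNodes → x t = 0) :
    ∑ l ∈ treesUpTo N, ∑ r ∈ treesUpTo N, rootCost l r * x (l △ r) ^ 2 =
      3 * (∑ a ∈ treesUpTo N, ∑ b ∈ treesUpTo N, ∑ c ∈ treesUpTo N, x ((a △ b) △ c) ^ 2 +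
        ∑ a ∈ treesUpTo N, ∑ b ∈ treesUpTo N, ∑ c ∈ treesUpTo N, x (a △ b △ c) ^ 2) +
      (goldenRatio - 1) *
        ((∑ a ∈ treesUpTo N, ∑ b ∈ treesUpTo N, ∑ c ∈ treesUpTo N, ∑ d ∈ treesUpTo N,
            x (((a △ b) △ c) △ d) ^ 2 +
          ∑ a ∈ treesUpTo N, ∑ b ∈ treesUpTo N, ∑ c ∈ treesUpTo N, ∑ d ∈ treesUpTo N,
            x ((a △ b △ c) △ d) ^ 2) +
        (∑ a ∈ treesUpTo N, ∑ b ∈ treesUpTo N, ∑ c ∈ treesUpTo N, ∑ d ∈ treesUpTo N,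
            x (a △ (b △ c) △ d) ^ 2 +
          ∑ a ∈ treesUpTo N, ∑ b ∈ treesUpTo N, ∑ c ∈ treesUpTo N, ∑ d ∈ treesUpTo N,
            x (a △ b △ c △ d) ^ 2)) -
      (2 - goldenRatio) *
        ∑ a ∈ treesUpTo N, ∑ b ∈ treesUpTo N, ∑ c ∈ treesUpTo N, ∑ d ∈ treesUpTo N,
          x ((a △ b) △ c △ d) ^ 2 := by
  set S := treesUpTo N
  have hz : ∀ t : BinaryTree Unit, N < t.numNodes → x t ^ 2 = 0 := fun t ht => by
    rw [hx t ht]; ring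
  have hl1 : ∑ l ∈ S, ∑ r ∈ S, nodeIndicator l * x (l △ r) ^ 2 =
      ∑ a ∈ S, ∑ b ∈ S, ∑ c ∈ S, x ((a △ b) △ c) ^ 2 := by
    simp only [← Finset.mul_sum]
    exact sum_nodeIndicator_mul fun t ht => Finset.sum_eq_zero fun r _ =>
      hz _ (by simp only [numNodes]; omega)
  have hr1 : ∑ l ∈ S, ∑ r ∈ S, nodeIndicator r * x (l △ r) ^ 2 =
      ∑ a ∈ S, ∑ b ∈ S, ∑ c ∈ S, x (a △ b △ c) ^ 2 :=
    Finset.sum_congr rfl fun a _ => sum_nodeIndicator_mul fun t ht =>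
      hz _ (by simp only [numNodes]; omega)
  have hl2 : ∑ l ∈ S, ∑ r ∈ S, childCount l * x (l △ r) ^ 2 =
      (∑ a ∈ S, ∑ b ∈ S, ∑ c ∈ S, ∑ d ∈ S, x (((a △ b) △ c) △ d) ^ 2) +
        ∑ a ∈ S, ∑ b ∈ S, ∑ c ∈ S, ∑ d ∈ S, x ((a △ b △ c) △ d) ^ 2 := by
    simp only [← Finset.mul_sum]
    exact sum_childCount_mul (F := fun l => ∑ d ∈ S, x (l △ d) ^ 2)
      fun t ht => Finset.sum_eq_zero fun r _ => hz _ (by simp only [numNodes]; omega)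
  have hr2 : ∑ l ∈ S, ∑ r ∈ S, childCount r * x (l △ r) ^ 2 =
      (∑ a ∈ S, ∑ b ∈ S, ∑ c ∈ S, ∑ d ∈ S, x (a △ (b △ c) △ d) ^ 2) +
        ∑ a ∈ S, ∑ b ∈ S, ∑ c ∈ S, ∑ d ∈ S, x (a △ b △ c △ d) ^ 2 := by
    rw [← Finset.sum_add_distrib]
    exact Finset.sum_congr rfl fun a _ => sum_childCount_mul (F := fun r => x (a △ r) ^ 2)
      fun t ht => hz _ (by simp only [numNodes]; omega)
  have hlr : ∑ l ∈ S, ∑ r ∈ S, nodeIndicator l * nodeIndicator r * x (l △ r) ^ 2 =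
      ∑ a ∈ S, ∑ b ∈ S, ∑ c ∈ S, ∑ d ∈ S, x ((a △ b) △ c △ d) ^ 2 := by
    simp only [mul_assoc, ← Finset.mul_sum]
    rw [sum_nodeIndicator_mul fun t ht => Finset.sum_eq_zero fun r _ => by
      rw [hz _ (by simp only [numNodes]; omega), mul_zero]]
    refine Finset.sum_congr rfl fun a _ => Finset.sum_congr rfl fun b _ => ?_
    exact sum_nodeIndicator_mul (F := fun r => x ((a △ b) △ r) ^ 2)
      fun t ht => hz _ (by simp only [numNodes]; omega)
  have hcost : ∑ l ∈ S, ∑ r ∈ S, rootCost l r * x (l △ r) ^ 2 =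
      3 * (∑ l ∈ S, ∑ r ∈ S, nodeIndicator l * x (l △ r) ^ 2 +
        ∑ l ∈ S, ∑ r ∈ S, nodeIndicator r * x (l △ r) ^ 2) +
      (goldenRatio - 1) * (∑ l ∈ S, ∑ r ∈ S, childCount l * x (l △ r) ^ 2 +
        ∑ l ∈ S, ∑ r ∈ S, childCount r * x (l △ r) ^ 2) -
      (2 - goldenRatio) *
        ∑ l ∈ S, ∑ r ∈ S, nodeIndicator l * nodeIndicator r * x (l △ r) ^ 2 := by
    simp only [Finset.mul_sum, ← Finset.sum_add_distrib, ← Finset.sum_sub_distrib]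
    refine Finset.sum_congr rfl fun l _ => Finset.sum_congr rfl fun r _ => ?_
    rw [rootCost]
    ring
  rw [hcost, hl1, hr1, hl2, hr2, hlr]

theorem sum_split_first {N : ℕ} {f : BinaryTree Unit → BinaryTree Unit → BinaryTree Unit → ℝ}
    (hf : ∀ a b c : BinaryTree Unit, N < a.numNodes → f a b c = 0) :
    ∑ a ∈ treesUpTo N, ∑ b ∈ treesUpTo N, ∑ c ∈ treesUpTo N, f a b c =
      ∑ b ∈ treesUpTo N, ∑ c ∈ treesUpTo N, f nil b c +
        ∑ a ∈ treesUpTo N, ∑ b ∈ treesUpTo N, ∑ c ∈ treesUpTo N, ∑ d ∈ treesUpTo N,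
          f (a △ b) c d :=
  sum_treesUpTo fun t ht => Finset.sum_eq_zero fun b _ => Finset.sum_eq_zero fun c _ =>
    hf t b c ht

theorem sum_split_second {N : ℕ} {f : BinaryTree Unit → BinaryTree Unit → BinaryTree Unit → ℝ}
    (hf : ∀ a b c : BinaryTree Unit, N < b.numNodes → f a b c = 0) :
    ∑ a ∈ treesUpTo N, ∑ b ∈ treesUpTo N, ∑ c ∈ treesUpTo N, f a b c =
      ∑ a ∈ treesUpTo N, ∑ c ∈ treesUpTo N, f a nil c +
        ∑ a ∈ treesUpTo N, ∑ b ∈ treesUpTo N, ∑ c ∈ treesUpTo N, ∑ d ∈ treesUpTo N,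
          f a (b △ c) d := by
  rw [← Finset.sum_add_distrib]
  exact Finset.sum_congr rfl fun a _ => sum_treesUpTo fun t ht =>
    Finset.sum_eq_zero fun c _ => hf a t c ht

theorem sum_split_third {N : ℕ} {f : BinaryTree Unit → BinaryTree Unit → BinaryTree Unit → ℝ}
    (hf : ∀ a b c : BinaryTree Unit, N < c.numNodes → f a b c = 0) :
    ∑ a ∈ treesUpTo N, ∑ b ∈ treesUpTo N, ∑ c ∈ treesUpTo N, f a b c =
      ∑ a ∈ treesUpTo N, ∑ b ∈ treesUpTo N, f a b nil +
        ∑ a ∈ treesUpTo N, ∑ b ∈ treesUpTo N, ∑ c ∈ treesUpTo N, ∑ d ∈ treesUpTo N,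
          f a b (c △ d) := by
  simp only [← Finset.sum_add_distrib]
  exact Finset.sum_congr rfl fun a _ => Finset.sum_congr rfl fun b _ =>
    sum_treesUpTo fun t ht => hf a b t ht

theorem sum_sq_add_sum_sq_add_nonneg {ι κ : Type*} (S : Finset ι) (T : Finset κ)
    (f g : ι → κ → ℝ) :
    0 ≤ ∑ a ∈ S, ∑ b ∈ T, f a b ^ 2 + ∑ a ∈ S, ∑ b ∈ T, g a b ^ 2 +
      2 * ∑ a ∈ S, ∑ b ∈ T, f a b * g a b := by
  simp only [Finset.mul_sum, ← Finset.sum_add_distrib]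
  refine Finset.sum_nonneg fun a _ => Finset.sum_nonneg fun b _ => ?_
  nlinarith [sq_nonneg (f a b + g a b)]

/-- Three of a pentagon's five edges are root rotations. Each root rotation should occur in three
pentagons, obtained by splitting `a`, `b` or `c`; where that subtree is empty, `2xy ≥ -(x² + y²)` is
used instead. Charging all three copies trivially and refunding the copies that do lie in pentagons
gives the bound; the balanced tree meets two root edges of its pentagon, hence its coefficient `2`.
-/
theorem three_mul_rootForm_ge {N : ℕ} {x : BinaryTree Unit → ℝ}
    (hx : ∀ t : BinaryTree Unit, N < t.numNodes → x t = 0) :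
    ∑ a ∈ treesUpTo N, ∑ b ∈ treesUpTo N, ∑ c ∈ treesUpTo N, ∑ d ∈ treesUpTo N,
        (x (((a △ b) △ c) △ d) ^ 2 + x ((a △ b △ c) △ d) ^ 2 +
        x (a △ (b △ c) △ d) ^ 2 + x (a △ b △ c △ d) ^ 2 + 2 * x ((a △ b) △ c △ d) ^ 2 +
        2 * (x ((a △ b △ c) △ d) * x (a △ (b △ c) △ d) +
        x ((a △ b) △ c △ d) * x (a △ b △ c △ d) +
        x (((a △ b) △ c) △ d) * x ((a △ b) △ c △ d))) -
      3 * (∑ a ∈ treesUpTo N, ∑ b ∈ treesUpTo N, ∑ c ∈ treesUpTo N, x ((a △ b) △ c) ^ 2 +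
        ∑ a ∈ treesUpTo N, ∑ b ∈ treesUpTo N, ∑ c ∈ treesUpTo N, x (a △ b △ c) ^ 2) ≤
      3 * rootForm N x := by
  have hz : ∀ t : BinaryTree Unit, N < t.numNodes → x t ^ 2 = 0 := fun t ht => by
    rw [hx t ht]; ring
  have A1 := sum_split_first (N := N) (f := fun a b c => x ((a △ b) △ c) ^ 2)
    fun a b c h => hz _ (by simp only [numNodes]; omega)
  have A2 := sum_split_second (N := N) (f := fun a b c => x ((a △ b) △ c) ^ 2)
    fun a b c h => hz _ (by simp only [numNodes]; omega)
  have A3 := sum_split_third (N := N) (f := fun a b c => x ((a △ b) △ c) ^ 2)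
    fun a b c h => hz _ (by simp only [numNodes]; omega)
  have B1 := sum_split_first (N := N) (f := fun a b c => x (a △ b △ c) ^ 2)
    fun a b c h => hz _ (by simp only [numNodes]; omega)
  have B2 := sum_split_second (N := N) (f := fun a b c => x (a △ b △ c) ^ 2)
    fun a b c h => hz _ (by simp only [numNodes]; omega)
  have B3 := sum_split_third (N := N) (f := fun a b c => x (a △ b △ c) ^ 2)
    fun a b c h => hz _ (by simp only [numNodes]; omega)
  have C1 := sum_split_first (N := N) (f := fun a b c => x ((a △ b) △ c) * x (a △ b △ c))
    fun a b c h => by rw [hx _ (by simp only [numNodes]; omega), zero_mul]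
  have C2 := sum_split_second (N := N) (f := fun a b c => x ((a △ b) △ c) * x (a △ b △ c))
    fun a b c h => by rw [hx _ (by simp only [numNodes]; omega), zero_mul]
  have C3 := sum_split_third (N := N) (f := fun a b c => x ((a △ b) △ c) * x (a △ b △ c))
    fun a b c h => by rw [hx _ (by simp only [numNodes]; omega), zero_mul]
  have D1 := sum_sq_add_sum_sq_add_nonneg (treesUpTo N) (treesUpTo N)
    (fun b c => x ((nil △ b) △ c))
    (fun b c => x (nil △ b △ c))
  have D2 := sum_sq_add_sum_sq_add_nonneg (treesUpTo N) (treesUpTo N)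
    (fun a c => x ((a △ nil) △ c))
    (fun a c => x (a △ nil △ c))
  have D3 := sum_sq_add_sum_sq_add_nonneg (treesUpTo N) (treesUpTo N)
    (fun a b => x ((a △ b) △ nil))
    (fun a b => x (a △ b △ nil))
  rw [rootForm]
  simp only [Finset.sum_add_distrib, ← Finset.mul_sum]
  linarith

/-- The two remaining pentagon edges are rotations at the left and at the right child of the root. A
pentagon costs `φ` per vertex, less the refund: `φ - 1` for four of its vertices and `φ - 2` for the
balanced one. -/
theorem neg_sum_rootCost_le {N : ℕ} {x : BinaryTree Unit → ℝ}
    (hx : ∀ t : BinaryTree Unit, N < t.numNodes → x t = 0) :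
    -∑ l ∈ treesUpTo N, ∑ r ∈ treesUpTo N, rootCost l r * x (l △ r) ^ 2 ≤
      ∑ r ∈ treesUpTo N, rootForm N (fun l => x (l △ r)) +
      ∑ l ∈ treesUpTo N, rootForm N (fun r => x (l △ r)) + 3 * rootForm N x := by
  have hleft : ∑ r ∈ treesUpTo N, rootForm N (fun l => x (l △ r)) =
      2 * ∑ a ∈ treesUpTo N, ∑ b ∈ treesUpTo N, ∑ c ∈ treesUpTo N, ∑ d ∈ treesUpTo N,
        x (((a △ b) △ c) △ d) * x ((a △ b △ c) △ d) := by
    simp only [rootForm]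
    rw [← Finset.mul_sum, Finset.sum_comm]
    congr 1
    refine Finset.sum_congr rfl fun a _ => ?_
    rw [Finset.sum_comm]
    exact Finset.sum_congr rfl fun b _ => Finset.sum_comm
  have hright : ∑ l ∈ treesUpTo N, rootForm N (fun r => x (l △ r)) =
      2 * ∑ a ∈ treesUpTo N, ∑ b ∈ treesUpTo N, ∑ c ∈ treesUpTo N, ∑ d ∈ treesUpTo N,
        x (a △ (b △ c) △ d) * x (a △ b △ c △ d) := by
    simp only [rootForm]
    rw [← Finset.mul_sum]
  have hroot := three_mul_rootForm_ge hx
  have hpent : 0 ≤ ∑ a ∈ treesUpTo N, ∑ b ∈ treesUpTo N, ∑ c ∈ treesUpTo N, ∑ d ∈ treesUpTo N,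
      (2 * (x (((a △ b) △ c) △ d) * x ((a △ b △ c) △ d) +
        x ((a △ b △ c) △ d) * x (a △ (b △ c) △ d) +
        x (a △ (b △ c) △ d) * x (a △ b △ c △ d) +
        x (a △ b △ c △ d) * x ((a △ b) △ c △ d) +
        x ((a △ b) △ c △ d) * x (((a △ b) △ c) △ d)) +
      goldenRatio * (x (((a △ b) △ c) △ d) ^ 2 + x ((a △ b △ c) △ d) ^ 2 +
        x (a △ (b △ c) △ d) ^ 2 + x (a △ b △ c △ d) ^ 2 + x ((a △ b) △ c △ d) ^ 2)) :=
    Finset.sum_nonneg fun a _ => Finset.sum_nonneg fun b _ => Finset.sum_nonneg fun c _ =>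
      Finset.sum_nonneg fun d _ => pentagon_form_nonneg _ _ _ _ _
  rw [sum_rootCost_mul hx, hleft, hright]
  refine le_trans ?_ (add_le_add_right hroot _)
  rw [← sub_nonneg]
  refine hpent.trans (le_of_eq ?_)
  have h : ∀ a b c d : BinaryTree Unit,
      2 * (x (((a △ b) △ c) △ d) * x ((a △ b △ c) △ d) +
        x ((a △ b △ c) △ d) * x (a △ (b △ c) △ d) +
        x (a △ (b △ c) △ d) * x (a △ b △ c △ d) +
        x (a △ b △ c △ d) * x ((a △ b) △ c △ d) +
        x ((a △ b) △ c △ d) * x (((a △ b) △ c) △ d)) +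
      goldenRatio * (x (((a △ b) △ c) △ d) ^ 2 + x ((a △ b △ c) △ d) ^ 2 +
        x (a △ (b △ c) △ d) ^ 2 + x (a △ b △ c △ d) ^ 2 + x ((a △ b) △ c △ d) ^ 2) =
      2 * (x (((a △ b) △ c) △ d) * x ((a △ b △ c) △ d)) +
      2 * (x (a △ (b △ c) △ d) * x (a △ b △ c △ d)) +
      (x (((a △ b) △ c) △ d) ^ 2 + x ((a △ b △ c) △ d) ^ 2 +
        x (a △ (b △ c) △ d) ^ 2 + x (a △ b △ c △ d) ^ 2 + 2 * x ((a △ b) △ c △ d) ^ 2 +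
        2 * (x ((a △ b △ c) △ d) * x (a △ (b △ c) △ d) +
        x ((a △ b) △ c △ d) * x (a △ b △ c △ d) +
        x (((a △ b) △ c) △ d) * x ((a △ b) △ c △ d))) +
      (goldenRatio - 1) * (x (((a △ b) △ c) △ d) ^ 2 + x ((a △ b △ c) △ d) ^ 2 +
        (x (a △ (b △ c) △ d) ^ 2 + x (a △ b △ c △ d) ^ 2)) -
      (2 - goldenRatio) * x ((a △ b) △ c △ d) ^ 2 := fun a b c d => by ring
  simp only [h]
  simp only [Finset.sum_add_distrib, Finset.sum_sub_distrib, ← Finset.mul_sum]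
  ring

/-- The total cost of a tree, bounding the rotation form from below. -/
noncomputable def treeCost : BinaryTree Unit → ℝ
  | .nil => 0
  | .node _ l r => treeCost l + treeCost r + rootCost l r / 4

/-- Each rotation is wanted four times: three times as a root rotation and once from the pentagon of
its parent. The root of the whole tree has no parent, so a quarter of `rootForm` stays uncovered.
The bound `k` on the support decreases on passing to the slices at a fixed sibling. -/
theorem neg_sum_treeCost_le (N k : ℕ) (hk : k ≤ N + 1) (x : BinaryTree Unit → ℝ)
    (hx : ∀ t : BinaryTree Unit, k ≤ t.numNodes → x t = 0) :
    -∑ t ∈ treesUpTo N, treeCost t * x t ^ 2 ≤ rotForm N x - rootForm N x / 4 := by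
  induction k generalizing x with
  | zero =>
    obtain rfl : x = 0 := funext fun t => hx t (Nat.zero_le _)
    simp [rotForm, rootForm]
  | succ k ih =>
    have hxN : ∀ t : BinaryTree Unit, N < t.numNodes → x t = 0 := fun t ht => hx t (by omega)
    have h1 := neg_sum_rootCost_le hxN
    have h2 := Finset.sum_le_sum fun r (_ : r ∈ treesUpTo N) =>
      ih (by omega) (fun l => x (l △ r)) fun l hl => hx _ (by simp only [numNodes]; omega)
    have h3 := Finset.sum_le_sum fun l (_ : l ∈ treesUpTo N) =>
      ih (by omega) (fun r => x (l △ r)) fun r hr => hx _ (by simp only [numNodes]; omega)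
    have h4 := rotForm_eq hxN
    rw [← rootForm] at h4
    rw [sum_treesUpTo fun t ht => by rw [hxN t ht]; ring]
    simp only [Finset.sum_neg_distrib, Finset.sum_sub_distrib, ← Finset.sum_div] at h2 h3
    rw [Finset.sum_comm] at h2
    have h5 : ∑ l ∈ treesUpTo N, ∑ r ∈ treesUpTo N, treeCost (l △ r) * x (l △ r) ^ 2 =
        ∑ l ∈ treesUpTo N, ∑ r ∈ treesUpTo N, treeCost l * x (l △ r) ^ 2 +
        ∑ l ∈ treesUpTo N, ∑ r ∈ treesUpTo N, treeCost r * x (l △ r) ^ 2 +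
        (∑ l ∈ treesUpTo N, ∑ r ∈ treesUpTo N, rootCost l r * x (l △ r) ^ 2) / 4 := by
      simp only [Finset.sum_div, ← Finset.sum_add_distrib]
      refine Finset.sum_congr rfl fun l _ => Finset.sum_congr rfl fun r _ => ?_
      rw [treeCost]
      ring
    rw [h5, h4, treeCost]
    linarith

theorem nodeIndicator_mem (t : BinaryTree Unit) : 0 ≤ nodeIndicator t ∧ nodeIndicator t ≤ 1 := by
  cases t <;> simp [nodeIndicator]

/-- The `childCount` terms telescope along the recursion; the only loss is the discount `(2 - φ)` at
nodes with two nonempty children. -/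
theorem treeCost_le (t : BinaryTree Unit) :
    treeCost t ≤ ((goldenRatio + 2) * (t.numNodes - nodeIndicator t) -
      (goldenRatio - 1) * childCount t) / 4 := by
  induction t using unitRecOn with
  | base => simp [treeCost, nodeIndicator, childCount]
  | ind l r ihl ihr =>
    have h1 := goldenRatio_lt_two
    have h2 := mul_nonneg (sub_nonneg.2 h1.le)
      (mul_nonneg (nodeIndicator_mem l).1 (nodeIndicator_mem r).1)
    have h3 : nodeIndicator (l △ r) = 1 := rfl
    have h4 : childCount (l △ r) = nodeIndicator l + nodeIndicator r := rfl
    rw [treeCost, rootCost, h3, h4, numNodes]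
    push_cast
    linarith

/-- The extra `childCount t / 4` pays for the uncovered quarter of the root rotations. It fits in
the slack of `treeCost_le` because `childCount ≤ 2` and `2 * (2 - φ) ≤ φ + 2`. -/
theorem treeCost_add_childCount_le (t : BinaryTree Unit) :
    treeCost t + childCount t / 4 ≤ (goldenRatio + 2) / 4 * t.numNodes := by
  have h := treeCost_le t
  have h1 := goldenRatio_lt_two
  have h2 := one_lt_goldenRatio
  cases t with
  | nil => simp [treeCost, childCount]
  | node _ l r =>
    have h3 : nodeIndicator (l △ r) = 1 := rfl
    have h4 : childCount (l △ r) = nodeIndicator l + nodeIndicator r := rfl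
    have h5 := (nodeIndicator_mem l).2
    have h6 := (nodeIndicator_mem r).2
    rw [h3] at h
    rw [h4] at h ⊢
    nlinarith

theorem neg_le_treeMin (m : ℕ) : -((goldenRatio + 2) / 4) * m ≤ treeMin m := by
  obtain ⟨x, hx0, hx⟩ := exists_rotForm_eq_treeMin m
  obtain ⟨hpos, heq⟩ := hx m le_rfl
  have hxN : ∀ t : BinaryTree Unit, m < t.numNodes → x t = 0 := fun t ht => hx0 t ht.ne'
  have h1 := neg_sum_treeCost_le m (m + 1) le_rfl x fun t ht => hxN t ht
  have h2 := neg_sum_childCount_le_rootForm hxN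
  have h3 : ∑ t ∈ treesUpTo m, treeCost t * x t ^ 2 +
      (∑ t ∈ treesUpTo m, childCount t * x t ^ 2) / 4 ≤
      (goldenRatio + 2) / 4 * m * ∑ t ∈ treesUpTo m, x t ^ 2 := by
    rw [Finset.sum_div, ← Finset.sum_add_distrib, Finset.mul_sum]
    refine Finset.sum_le_sum fun t _ => ?_
    by_cases ht : t.numNodes = m
    · have := mul_le_mul_of_nonneg_right (treeCost_add_childCount_le t) (sq_nonneg (x t))
      rw [ht] at this
      linarith
    · rw [hx0 t ht]; simp
  refine le_of_mul_le_mul_right ?_ hpos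
  linarith

/-! ### Fekete's lemma and the asymptotics -/

/-- The smallest eigenvalue of the rotation graph, indexed by the number of leaves. -/
noncomputable def leafMin : ℕ → ℝ
  | 0 => 0
  | k + 1 => treeMin k

/-- Counting leaves absorbs the `+ 1` of `treeMin_add_le`. The convention `leafMin 0 = 0` makes the
degenerate cases trivial. -/
theorem subadditive_leafMin : Subadditive leafMin := by
  intro i j
  cases i with
  | zero => simp [leafMin]
  | succ i =>
    cases j with
    | zero => simp [leafMin]
    | succ j =>
      rw [show i + 1 + (j + 1) = i + j + 1 + 1 by ring]
      exact treeMin_add_le i j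

theorem lambdaMin_eq_leafMin {k : ℕ} (hk : 3 ≤ k) : lambdaMin (k + 1) = leafMin k := by
  obtain ⟨m, rfl⟩ := Nat.exists_eq_add_of_le' hk
  exact lambdaMin_eq (m := m + 2) (by omega)

theorem neg_le_leafMin (k : ℕ) : -((goldenRatio + 2) / 4) * k ≤ leafMin k := by
  cases k with
  | zero => simp [leafMin]
  | succ k =>
    have h := neg_le_treeMin k
    have := goldenRatio_pos
    rw [leafMin]
    push_cast
    linarith

theorem neg_le_leafMin_div (k : ℕ) : -((goldenRatio + 2) / 4) ≤ leafMin k / k := by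
  rcases Nat.eq_zero_or_pos k with rfl | hk
  · have := goldenRatio_pos
    simp only [CharP.cast_eq_zero, div_zero]
    linarith
  · rw [le_div_iff₀ (by exact_mod_cast hk)]
    exact neg_le_leafMin k

theorem bddBelow_leafMin_div : BddBelow (Set.range fun k => leafMin k / k) :=
  ⟨_, Set.forall_mem_range.2 neg_le_leafMin_div⟩

/-- Divide `k` by `m + 1` for the good `m`: the quotient contributes the linear term, and `C`
absorbs the finitely many remainders. One constant then serves every residue class modulo 10. -/
theorem exists_leafMin_le : ∃ C : ℝ, ∀ k : ℕ, leafMin k ≤ -0.6904 * k + C := by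
  obtain ⟨m, hm⟩ := exists_treeMin_lt
  refine ⟨∑ s ∈ Finset.range (m + 1), |leafMin s| + 0.6904 * (m + 1), fun k => ?_⟩
  have h1 := subadditive_leafMin.apply_mul_add_le (k / (m + 1)) (m + 1) (k % (m + 1))
  rw [Nat.div_add_mod'] at h1
  have hlt : k % (m + 1) < m + 1 := Nat.mod_lt _ (Nat.succ_pos m)
  have h2 : leafMin (k % (m + 1)) ≤ ∑ s ∈ Finset.range (m + 1), |leafMin s| :=
    (le_abs_self _).trans (Finset.single_le_sum (f := fun s => |leafMin s|)
      (fun s _ => abs_nonneg _) (Finset.mem_range.2 hlt))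
  have h3 : ((k / (m + 1) : ℕ) : ℝ) * leafMin (m + 1) ≤
      ((k / (m + 1) : ℕ) : ℝ) * (-0.6904 * (m + 1)) :=
    mul_le_mul_of_nonneg_left hm.le (Nat.cast_nonneg _)
  have h4 : ((k / (m + 1) : ℕ) : ℝ) * (m + 1) + ((k % (m + 1) : ℕ) : ℝ) = k := by
    exact_mod_cast Nat.div_add_mod' k (m + 1)
  have h5 : ((k % (m + 1) : ℕ) : ℝ) ≤ m + 1 := by exact_mod_cast hlt.le
  linarith

theorem tendsto_lambdaMin_div :
    Filter.Tendsto (fun n : ℕ => lambdaMin n / ((n : ℝ) - 3)) Filter.atTop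
      (nhds subadditive_leafMin.lim) := by
  rw [← Filter.tendsto_add_atTop_iff_nat 4]
  have h1 := (Filter.tendsto_add_atTop_iff_nat 3).2
    (subadditive_leafMin.tendsto_lim bddBelow_leafMin_div)
  -- `1 + 2/(n + 1) = (n + 3)/(n + 1)` converts division by the number of leaves into division by
  -- the number of diagonals.
  have h2 : Filter.Tendsto (fun n : ℕ => 1 + 2 * (1 / ((n : ℝ) + 1))) Filter.atTop
      (nhds (1 + 2 * 0)) :=
    (tendsto_one_div_add_atTop_nhds_zero_nat.const_mul 2).const_add 1
  have h3 := h1.mul h2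
  rw [mul_zero, add_zero, mul_one] at h3
  refine h3.congr fun n => ?_
  rw [lambdaMin_eq_leafMin (by omega : 3 ≤ n + 3)]
  have h4 : (n : ℝ) + 1 ≠ 0 := by positivity
  have h5 : (n : ℝ) + 3 ≠ 0 := by positivity
  push_cast
  rw [show (n : ℝ) + 4 - 3 = n + 1 by ring]
  field_simp
  ring

theorem leafMin_lim_le : subadditive_leafMin.lim ≤ -0.6904 := by
  obtain ⟨m, hm⟩ := exists_treeMin_lt
  refine (subadditive_leafMin.lim_le_div bddBelow_leafMin_div (Nat.succ_ne_zero m)).trans ?_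
  rw [div_le_iff₀ (by positivity)]
  push_cast
  exact hm.le

theorem neg_le_leafMin_lim : -((goldenRatio + 2) / 4) ≤ subadditive_leafMin.lim :=
  ge_of_tendsto' (subadditive_leafMin.tendsto_lim bddBelow_leafMin_div) neg_le_leafMin_div

theorem isTheta_lambdaMin :
    Asymptotics.IsTheta Filter.atTop (fun n : ℕ => |lambdaMin n|) (fun n : ℕ => (n : ℝ)) := by
  obtain ⟨C, hC⟩ := exists_leafMin_le
  have hφ := goldenRatio_lt_two
  have hn : ∀ n : ℕ, 4 ≤ n → -n ≤ lambdaMin n ∧ lambdaMin n ≤ -0.6904 * n + (0.6904 + C) := by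
    intro n hn
    obtain ⟨k, rfl⟩ := Nat.exists_eq_add_of_le' (by omega : 1 ≤ n)
    have h1 := hC k
    have h2 := neg_le_leafMin k
    have h3 : (0 : ℝ) ≤ k := Nat.cast_nonneg k
    rw [lambdaMin_eq_leafMin (by omega)]
    push_cast
    constructor
    · nlinarith
    · linarith
  -- For `n ≥ M` the constant is at most `n/5`, so `lambdaMin n ≤ -0.4904 * n`; the factor `5` below
  -- is more than enough.
  obtain ⟨M, hM⟩ := exists_nat_ge (5 * (0.6904 + C))
  constructor
  · refine Asymptotics.IsBigO.of_bound 1 ?_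
    filter_upwards [Filter.eventually_ge_atTop 4, Filter.eventually_ge_atTop M] with n h4 hMn
    have h := hn n h4
    have h5 : (M : ℝ) ≤ n := by exact_mod_cast hMn
    simp only [Real.norm_eq_abs, abs_abs, Nat.abs_cast, one_mul]
    rw [abs_le]
    constructor <;> linarith [(Nat.cast_nonneg n : (0 : ℝ) ≤ n)]
  · refine Asymptotics.IsBigO.of_bound 5 ?_
    filter_upwards [Filter.eventually_ge_atTop 4, Filter.eventually_ge_atTop M] with n h4 hMn
    have h := hn n h4
    have h5 : (M : ℝ) ≤ n := by exact_mod_cast hMn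
    simp only [Real.norm_eq_abs, abs_abs, Nat.abs_cast]
    linarith [neg_le_abs (lambdaMin n), (Nat.cast_nonneg n : (0 : ℝ) ≤ n)]

end Associahedron

theorem mainTheorem7 :
    (∃ c : Fin 10 → ℝ, ∀ n : ℕ, 4 ≤ n →
      Associahedron.lambdaMin n ≤ -0.6904 * (n : ℝ) + c (Fin.ofNat 10 n)) ∧
    (∃ L : ℝ,
      Filter.Tendsto (fun n : ℕ => Associahedron.lambdaMin n / ((n : ℝ) - 3))
        Filter.atTop (nhds L) ∧
      -(5 + Real.sqrt 5) / 8 ≤ L ∧ L ≤ -0.6904) ∧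
    Asymptotics.IsTheta Filter.atTop
      (fun n : ℕ => |Associahedron.lambdaMin n|) (fun n : ℕ => (n : ℝ)) := by
  refine ⟨?_, ⟨_, Associahedron.tendsto_lambdaMin_div, ?_, Associahedron.leafMin_lim_le⟩,
    Associahedron.isTheta_lambdaMin⟩
  · obtain ⟨C, hC⟩ := Associahedron.exists_leafMin_le
    refine ⟨fun _ => 0.6904 + C, fun n hn => ?_⟩
    obtain ⟨k, rfl⟩ := Nat.exists_eq_add_of_le' (by omega : 1 ≤ n)
    rw [Associahedron.lambdaMin_eq_leafMin (by omega)]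
    have := hC k
    push_cast
    linarith
  · refine le_trans (le_of_eq ?_) Associahedron.neg_le_leafMin_lim
    rw [Real.goldenRatio]
    ring
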